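/- A \emph{squares category} $\mathcal{D}$ is a small double category whose 2-cells (the \emph{distinguished squares}) are determined by their boundaries, with category of horizontal morphisms $\mathcal{M}_{\mathcal D}$ and category of vertical morphisms $\mathcal{E}_{\mathcal D}$, together with an object $O$ that is initial in both $\mathcal{M}_{\mathcal D}$ and $\mathcal{E}_{\mathcal D}$. Let $T_n\mathcal{D}$ be the category whose objects are the functors $F\colon[n]\to\mathcal{M}_{\mathcal D}$ and whose morphisms $F\Rightarrow G$ are families of vertical morphisms $F(i)\to G(i)$ such that for all $i\le j$ the square formed by $F(i)\to F(j)$, $G(i)\to G(j)$ and the two vertical morphisms is distinguished. Precomposition makes $T_\bullet\mathcal{D}$ a simplicial category, and \[K^\square(\mathcal{D})=\Omega_O|N_\bullet T_\bullet\mathcal{D}|.\] Let $\mathcal{C}$ be a small Waldhausen category, i.e. a category with a chosen zero object $*$, a subcategory of cofibrations and a subcategory of weak equivalences, both containing all isomorphisms, such that all maps $*\to A$ are cofibrations, pushouts along cofibrations exist and cofibrations are stable under them, and the gluing axiom holds. Let $wS_n\mathcal{C}$ be the category of diagrams $A\colon \mathrm{Ar}[n]\to\mathcal{C}$ with $A_{j,j}=*$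 such that, for $i\le j\le k$, the map $A_{i,j}\to A_{i,k}$ is a cofibration and the square on $A_{i,j},A_{i,k},A_{j,j},A_{j,k}$ is a pushout; its morphisms are the natural transformations all of whose components are weak equivalences. Waldhausen's $K$-theory is $K^W(\mathcal{C})=\Omega|N_\bullet wS_\bullet\mathcal{C}|$, with the loops based at the vertex given by the unique object of $wS_0\mathcal{C}$. Let $\mathcal{C}'$ be the squares category with the same objects as $\mathcal{C}$, whose horizontal morphisms are the cofibrations, whose vertical morphisms are all morphisms of $\mathcal{C}$, whose distinguished squares are the commutative squares \[\begin{array}{ccc}A&\rightarrowtail&B\\ \downarrow&&\downarrow\\ C&\rightarrowtail&D\end{array}\] for which the induced map $B\cup_A C\to D$ is a weak equivalence, and whose base object $O$ is the zero object. Then \[K^W(\mathcal{C})\simeq K^\square(\mathcal{C}')\] as loop spaces: there is a based continuous map $|N_\bullet wS_\bullet\mathcal{C}|\to|N_\bullet T_\bullet\mathcal{C}'|$ whose loop map $K^W(\mathcal{C})\to K^\square(\mathcal{C}')$ is a homotopy equivalence. -/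

import Mathlib

open CategoryTheory Opposite Simplicial ContinuousMap

universe v u

/-! ### Simple double categories and squares categories -/

/-- A (small) double category on the objects `Ob` in which a 2-cell is determined by its boundary.
`hor` is the category of horizontal morphisms `A ↣ B`, `ver` the category of vertical morphisms,
and `IsDist f f' g g'` says that the square
```
A --f--> B
|g       |g'
C --f'-> D
```
is distinguished. -/
structure SimpleDoubleCategory (Ob : Type u) where
  hor : Category.{v} Ob
  ver : Category.{v} Ob
  IsDist : ∀ {A B C D : Ob},
    hor.Hom A B → hor.Hom C D → ver.Hom A C → ver.Hom B D → Prop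
  dist_vcomp : ∀ {A B C D E F : Ob} {f : hor.Hom A B} {f' : hor.Hom C D} {f'' : hor.Hom E F}
    {g : ver.Hom A C} {g' : ver.Hom B D} {k : ver.Hom C E} {k' : ver.Hom D F},
    IsDist f f' g g' → IsDist f' f'' k k' → IsDist f f'' (ver.comp g k) (ver.comp g' k')
  dist_hcomp : ∀ {A B C D E F : Ob} {f : hor.Hom A B} {h : hor.Hom B C} {f' : hor.Hom D E}
    {h' : hor.Hom E F} {g : ver.Hom A D} {g' : ver.Hom B E} {g'' : ver.Hom C F},
    IsDist f f' g g' → IsDist h h' g' g'' → IsDist (hor.comp f h) (hor.comp f' h') g g''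
  dist_ver_id : ∀ {A B : Ob} (f : hor.Hom A B), IsDist f f (ver.id A) (ver.id B)
  dist_hor_id : ∀ {A B : Ob} (g : ver.Hom A B), IsDist (hor.id A) (hor.id B) g g

/-- A squares category: a simple double category with a chosen object that is initial both
horizontally and vertically. -/
structure SquaresCategory (Ob : Type u) extends SimpleDoubleCategory.{v} Ob where
  base : Ob
  base_hor_initial : Nonempty (@Limits.IsInitial Ob hor base)
  base_ver_initial : Nonempty (@Limits.IsInitial Ob ver base)

namespace SquaresCategory

variable {Ob : Type u} (S : SquaresCategory.{v} Ob)

/-- The objects, regarded as the objects of the category of horizontal morphisms. -/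
def Hor (_ : SquaresCategory.{v} Ob) : Type u := Ob

instance : Category.{v} S.Hor := S.hor

/-- Horizontal functors from `D` to `S`. -/
structure HFun (D : Type) [Category.{0} D] where
  functor : D ⥤ S.Hor

variable {S}

/-- Vertical distinguished transformations between horizontal functors. -/
@[ext]
structure HFun.Hom {D : Type} [Category.{0} D] (F G : S.HFun D) where
  app : ∀ d : D, S.ver.Hom (F.functor.obj d) (G.functor.obj d)
  dist : ∀ {d d' : D} (f : d ⟶ d'),
    S.IsDist (F.functor.map f) (G.functor.map f) (app d) (app d')

/-- The category of horizontal functors and vertical distinguished transformations. -/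
instance (D : Type) [Category.{0} D] : Category.{v} (S.HFun D) where
  Hom F G := HFun.Hom F G
  id F := ⟨fun d => S.ver.id (F.functor.obj d), fun _ => S.dist_ver_id _⟩
  comp α β := ⟨fun d => S.ver.comp (α.app d) (β.app d),
    fun f => S.dist_vcomp (α.dist f) (β.dist f)⟩
  id_comp _ := HFun.Hom.ext (funext fun _ => S.ver.id_comp _)
  comp_id _ := HFun.Hom.ext (funext fun _ => S.ver.comp_id _)
  assoc _ _ _ := HFun.Hom.ext (funext fun _ => S.ver.assoc _ _ _)

/-- Restriction of horizontal functors along a functor `D ⥤ D'`. -/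
def HFun.precomp {D D' : Type} [Category.{0} D] [Category.{0} D'] (G : D ⥤ D') :
    S.HFun D' ⥤ S.HFun D where
  obj F := ⟨G ⋙ F.functor⟩
  map α := ⟨fun d => α.app (G.obj d), fun f => α.dist (G.map f)⟩

variable (S)

/-- The simplicial category `T_• S`, with `T_n S` the category of horizontal functors
`[n] ⟶ S`. -/
def T : SimplexCategoryᵒᵖ ⥤ Cat.{v, max u v} where
  obj n := Cat.of (S.HFun (Fin (n.unop.len + 1)))
  map θ := (HFun.precomp θ.unop.toOrderHom.monotone.functor).toCatHom
  map_id _ := rfl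
  map_comp _ _ := rfl

/-- The base object, as an object of `T_0 S`. -/
def baseT₀ : S.T.obj (op ⦋0⦌) :=
  HFun.mk ((Functor.const (Fin 1)).obj (show S.Hor from S.base))

end SquaresCategory

/-! ### Realizations of simplicial categories -/

/-- The diagonal of a bisimplicial set. -/
def SSet.diagonal (X : SimplexCategoryᵒᵖ ⥤ SSet.{u}) : SSet.{u} where
  obj n := (X.obj n).obj n
  map θ := (X.map θ).app _ ≫ (X.obj _).map θ
  map_id n := by simp
  map_comp θ θ' := by simp

/-- The diagonal of the levelwise nerve of a simplicial category. -/
def SimplicialCat.diagNerve (X : SimplexCategoryᵒᵖ ⥤ Cat.{v, u}) : SSet.{max u v} :=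
  SSet.diagonal (X ⋙ nerveFunctor)

/-- The geometric realization `|N_• X_•|` of a simplicial category. -/
noncomputable def SimplicialCat.realization (X : SimplexCategoryᵒᵖ ⥤ Cat.{v, u}) :
    TopCat.{max u v} :=
  SSet.toTop.obj (SimplicialCat.diagNerve X)

/-- The point of `|Y|` given by a vertex of `Y`. -/
noncomputable def SSet.vertexPoint (Y : SSet.{u}) (y : Y.obj (op ⦋0⦌)) : SSet.toTop.obj Y :=
  TopCat.toSSetObj₀Equiv ((sSetTopAdj.unit.app Y).app (op ⦋0⦌) y)

/-- The point of `|N_• X_•|` given by an object of `X_0`. -/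
noncomputable def SimplicialCat.point (X : SimplexCategoryᵒᵖ ⥤ Cat.{v, u})
    (x : X.obj (op ⦋0⦌)) : SimplicialCat.realization X :=
  SSet.vertexPoint (SimplicialCat.diagNerve X) (ComposableArrows.mk₀ x)

/-! ### Squares K-theory -/

namespace SquaresCategory

variable {Ob : Type u} (S : SquaresCategory.{v} Ob)

/-- The point `O` of `|N_• T_• S|`. -/
noncomputable def basePoint : SimplicialCat.realization S.T := SimplicialCat.point S.T S.baseT₀

/-- The K-theory space `Ω_O |N_• T_• S|` of a squares category, with the compact-open topology. -/
abbrev K : Type (max u v) := LoopSpace (SimplicialCat.realization S.T) S.basePoint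

end SquaresCategory

/-! ### Waldhausen categories -/

/-- The structure of a Waldhausen category (a category with cofibrations and weak equivalences)
on a category `C`. -/
structure WaldhausenCategory (C : Type u) [Category.{v} C] where
  /-- the distinguished zero object -/
  zero : C
  isZero_zero : Limits.IsZero zero
  /-- the cofibrations -/
  cof : MorphismProperty C
  cof_of_isIso : ∀ {A B : C} (f : A ⟶ B) [IsIso f], cof f
  cof_comp : ∀ {A B D : C} (f : A ⟶ B) (g : B ⟶ D), cof f → cof g → cof (f ≫ g)
  cof_from_zero : ∀ {A : C} (f : zero ⟶ A), cof f
  hasPushout : ∀ {A B D : C} (f : A ⟶ B) (g : A ⟶ D), cof f → Limits.HasPushout f g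
  cof_pushout : ∀ {A B D P : C} {f : A ⟶ B} {g : A ⟶ D} {inl : B ⟶ P} {inr : D ⟶ P},
    IsPushout f g inl inr → cof f → cof inr
  /-- the weak equivalences -/
  weq : MorphismProperty C
  weq_of_isIso : ∀ {A B : C} (f : A ⟶ B) [IsIso f], weq f
  weq_comp : ∀ {A B D : C} (f : A ⟶ B) (g : B ⟶ D), weq f → weq g → weq (f ≫ g)
  /-- the gluing axiom: a map of spans `(B ↢ A ⟶ D) ⟶ (B' ↢ A' ⟶ D')` consisting of weak
  equivalences induces a weak equivalence between the pushouts -/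
  gluing : ∀ {A B D P A' B' D' P' : C} {f : A ⟶ B} {g : A ⟶ D} {inl : B ⟶ P} {inr : D ⟶ P}
    {f' : A' ⟶ B'} {g' : A' ⟶ D'} {inl' : B' ⟶ P'} {inr' : D' ⟶ P'}
    {a : A ⟶ A'} {b : B ⟶ B'} {d : D ⟶ D'} {p : P ⟶ P'},
    IsPushout f g inl inr → IsPushout f' g' inl' inr' → cof f → cof f' →
    f ≫ b = a ≫ f' → g ≫ d = a ≫ g' → inl ≫ p = b ≫ inl' → inr ≫ p = d ≫ inr' →
    weq a → weq b → weq d → weq p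

namespace WaldhausenCategory

variable {C : Type u} [Category.{v} C] (W : WaldhausenCategory C)

/-! #### The associated squares category -/

/-- A square with horizontal cofibrations `f`, `f'` and vertical morphisms `g`, `g'` is
distinguished if it commutes and the induced map `B ∪_A D ⟶ E` is a weak equivalence. -/
def IsDist {A B D E : C} (f : A ⟶ B) (f' : D ⟶ E) (g : A ⟶ D) (g' : B ⟶ E) : Prop :=
  ∃ w : f ≫ g' = g ≫ f', ∀ {P : C} {inl : B ⟶ P} {inr : D ⟶ P} (h : IsPushout f g inl inr),
    W.weq (h.desc g' f' w)

variable {W}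

lemma IsDist.mk_of {A B D E : C} {f : A ⟶ B} {f' : D ⟶ E} {g : A ⟶ D} {g' : B ⟶ E} {P : C}
    {inl : B ⟶ P} {inr : D ⟶ P} (h : IsPushout f g inl inr) (t : P ⟶ E)
    (hl : inl ≫ t = g') (hr : inr ≫ t = f') (ht : W.weq t) : W.IsDist f f' g g' := by
  have w : f ≫ g' = g ≫ f' := by rw [← hl, ← hr, h.w_assoc]
  refine ⟨w, fun {P'} inl' inr' h' => ?_⟩
  have e : h'.desc g' f' w = (h'.isoIsPushout _ _ h).hom ≫ t := by
    apply h'.hom_ext <;> simp [hl, hr]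
  rw [e]
  exact W.weq_comp _ _ (W.weq_of_isIso _) ht

lemma IsDist.exists_of {A B D E : C} {f : A ⟶ B} {f' : D ⟶ E} {g : A ⟶ D} {g' : B ⟶ E}
    (H : W.IsDist f f' g g') (hf : W.cof f) :
    ∃ (P : C) (inl : B ⟶ P) (inr : D ⟶ P) (_ : IsPushout f g inl inr) (t : P ⟶ E),
      inl ≫ t = g' ∧ inr ≫ t = f' ∧ W.weq t := by
  have := W.hasPushout f g hf
  obtain ⟨w, H⟩ := H
  have h := IsPushout.of_hasPushout f g
  exact ⟨_, _, _, h, h.desc g' f' w, by simp, by simp, H h⟩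

lemma IsDist.vcomp {A B D E F G : C} {f : A ⟶ B} {f' : D ⟶ E} {f'' : F ⟶ G}
    {g : A ⟶ D} {g' : B ⟶ E} {k : D ⟶ F} {k' : E ⟶ G} (hf : W.cof f) (hf' : W.cof f')
    (H : W.IsDist f f' g g') (H' : W.IsDist f' f'' k k') :
    W.IsDist f f'' (g ≫ k) (g' ≫ k') := by
  obtain ⟨P, inl, inr, h, t, hl, hr, ht⟩ := H.exists_of hf
  obtain ⟨Q, inl', inr', h', t', hl', hr', ht'⟩ := H'.exists_of hf'
  have hi : W.cof inr := W.cof_pushout h hf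
  have := W.hasPushout inr k hi
  have hR := IsPushout.of_hasPushout inr k
  -- the pushout of `f` along `g ≫ k`
  have hRR := h.flip.paste_horiz hR.flip
  let s : Limits.pushout inr k ⟶ Q := hR.desc (t ≫ inl') inr' (by
    rw [← Category.assoc, hr, h'.w])
  have hs : W.weq s := W.gluing hR h' hi hf' (a := 𝟙 D) (b := t) (d := 𝟙 F) (p := s)
    (by simp [hr]) (by simp) (by simp [s]) (by simp [s])
    (W.weq_of_isIso _) ht (W.weq_of_isIso _)
  refine IsDist.mk_of hRR.flip (s ≫ t') ?_ ?_ (W.weq_comp _ _ hs ht')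
  · simp [s, hl', reassoc_of% hl]
  · simp [s, hr']

lemma IsDist.hcomp {A B D E F G : C} {f : A ⟶ B} {h : B ⟶ D} {f' : E ⟶ F} {h' : F ⟶ G}
    {g : A ⟶ E} {g' : B ⟶ F} {g'' : D ⟶ G} (hf : W.cof f) (hh : W.cof h)
    (H : W.IsDist f f' g g') (H' : W.IsDist h h' g' g'') :
    W.IsDist (f ≫ h) (f' ≫ h') g g'' := by
  obtain ⟨P, inl, inr, hP, t, hl, hr, ht⟩ := H.exists_of hf
  obtain ⟨Q, inl', inr', hQ, t', hl', hr', ht'⟩ := H'.exists_of hh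
  have := W.hasPushout h inl hh
  have hR := IsPushout.of_hasPushout h inl
  let s : Limits.pushout h inl ⟶ Q := hR.desc inl' (t ≫ inr') (by
    rw [← Category.assoc, hl, hQ.w])
  have hs : W.weq s := W.gluing hR hQ hh hh (a := 𝟙 B) (b := 𝟙 D) (d := t) (p := s)
    (by simp) (by simp [hl]) (by simp [s]) (by simp [s])
    (W.weq_of_isIso _) (W.weq_of_isIso _) ht
  refine IsDist.mk_of (hP.paste_horiz hR) (s ≫ t') ?_ ?_ (W.weq_comp _ _ hs ht')
  · simp [s, hl']
  · simp [s, hr', reassoc_of% hr]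

variable (W)

/-- The category of cofibrations. -/
@[reducible]
def cofCategory : Category.{v} C where
  Hom A B := { f : A ⟶ B // W.cof f }
  id A := ⟨𝟙 A, W.cof_of_isIso _⟩
  comp f g := ⟨f.1 ≫ g.1, W.cof_comp _ _ f.2 g.2⟩

/-- The squares category associated with a Waldhausen category: horizontal morphisms are the
cofibrations, vertical morphisms are all morphisms. -/
def squaresCategory : SquaresCategory.{v} C where
  hor := W.cofCategory
  ver := inferInstance
  IsDist f f' g g' := W.IsDist f.1 f'.1 g g'
  dist_vcomp {_ _ _ _ _ _ f f' _ _ _ _ _} H H' := H.vcomp f.2 f'.2 H'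
  dist_hcomp {_ _ _ _ _ _ f h _ _ _ _ _} H H' := H.hcomp f.2 h.2 H'
  dist_ver_id f := IsDist.mk_of (IsPushout.of_vert_isIso ⟨by simp⟩ : IsPushout f.1 (𝟙 _) (𝟙 _) f.1)
    (𝟙 _) (by simp) (by simp) (W.weq_of_isIso _)
  dist_hor_id g := IsDist.mk_of (IsPushout.of_horiz_isIso ⟨by simp⟩ : IsPushout (𝟙 _) g g (𝟙 _))
    (𝟙 _) (by simp) (Category.comp_id (𝟙 _)) (W.weq_of_isIso _)
  base := W.zero
  base_hor_initial := ⟨@Limits.IsInitial.ofUniqueHom C W.cofCategory W.zero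
    (fun A => ⟨W.isZero_zero.to_ A, W.cof_from_zero _⟩)
    (fun _ _ => Subtype.ext (W.isZero_zero.eq_of_src _ _))⟩
  base_ver_initial := ⟨W.isZero_zero.isInitial⟩

/-! #### The `S_•`-construction and Waldhausen K-theory -/

/-- The objects of `S_n C`: diagrams `A : Ar[n] ⥤ C` with `A_{j,j}` the zero object, such that for
`i ≤ j ≤ k` the map `A_{i,j} ⟶ A_{i,k}` is a cofibration and the square with corners
`A_{i,j}`, `A_{i,k}`, `A_{j,j}`, `A_{j,k}` is a pushout. -/
structure SObj (n : ℕ) where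
  functor : Arrow (Fin (n + 1)) ⥤ C
  obj_diag : ∀ j : Fin (n + 1), functor.obj (Arrow.mk (𝟙 j)) = W.zero
  cof_map : ∀ {i j k : Fin (n + 1)} (f : i ⟶ j) (g : j ⟶ k),
    W.cof (functor.map (Arrow.homMk (𝟙 i) g : Arrow.mk f ⟶ Arrow.mk (f ≫ g)))
  isPushout : ∀ {i j k : Fin (n + 1)} (f : i ⟶ j) (g : j ⟶ k),
    IsPushout (functor.map (Arrow.homMk (𝟙 i) g : Arrow.mk f ⟶ Arrow.mk (f ≫ g)))
      (functor.map (Arrow.homMk f (𝟙 j) : Arrow.mk f ⟶ Arrow.mk (𝟙 j)))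
      (functor.map (Arrow.homMk f (𝟙 k) : Arrow.mk (f ≫ g) ⟶ Arrow.mk g))
      (functor.map (Arrow.homMk (𝟙 j) g : Arrow.mk (𝟙 j) ⟶ Arrow.mk g))

variable {W}

/-- The morphisms of `wS_n C`: natural transformations all of whose components are weak
equivalences. -/
@[ext]
structure SObj.Hom {n : ℕ} (A B : W.SObj n) where
  natTrans : A.functor ⟶ B.functor
  weq : ∀ x, W.weq (natTrans.app x)

/-- The category `wS_n C`. -/
instance (n : ℕ) : Category.{v} (W.SObj n) where
  Hom A B := SObj.Hom A B
  id A := ⟨𝟙 _, fun _ => W.weq_of_isIso _⟩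
  comp α β := ⟨α.natTrans ≫ β.natTrans, fun x => W.weq_comp _ _ (α.weq x) (β.weq x)⟩

/-- The functor `wS_n C ⥤ wS_m C` induced by a monotone map `[m] ⟶ [n]`. -/
def SObj.precomp {m n : ℕ} (θ : Fin (m + 1) →o Fin (n + 1)) : W.SObj n ⥤ W.SObj m where
  obj A :=
    { functor := θ.monotone.functor.mapArrow ⋙ A.functor
      obj_diag := fun j => A.obj_diag (θ j)
      cof_map := fun f g => A.cof_map (θ.monotone.functor.map f) (θ.monotone.functor.map g)
      isPushout := fun f g =>
        A.isPushout (θ.monotone.functor.map f) (θ.monotone.functor.map g) }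
  map α := ⟨Functor.whiskerLeft _ α.natTrans, fun _ => α.weq _⟩

variable (W)

/-- The simplicial category `wS_• C`. -/
def wS : SimplexCategoryᵒᵖ ⥤ Cat.{v, max u v} where
  obj n := Cat.of (W.SObj n.unop.len)
  map θ := (SObj.precomp θ.unop.toOrderHom).toCatHom
  map_id _ := rfl
  map_comp _ _ := rfl

/-- The (only) object of `wS_0 C`, the diagram with value the zero object. -/
def baseS₀ : W.wS.obj (op ⦋0⦌) :=
  SObj.mk (W := W) (n := 0) ((Functor.const (Arrow (Fin 1))).obj W.zero) (fun _ => rfl)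
    (fun _ _ => W.cof_of_isIso (𝟙 W.zero)) (fun _ _ => IsPushout.of_id_fst)

/-- The base point of `|wS_• C|`. -/
noncomputable def basePoint : SimplicialCat.realization W.wS := SimplicialCat.point W.wS W.baseS₀

/-- The Waldhausen K-theory space `Ω|wS_• C|`, with the compact-open topology. -/
abbrev K : Type (max u v) := LoopSpace (SimplicialCat.realization W.wS) W.basePoint

end WaldhausenCategory

/-! ### Ordered couplings of finite measures -/

namespace stdSimplex

/-! Passing to quotients sends a chain of cofibrations `F` to the diagram of all `F(j)/F(i)`. By the
gluing axiom a distinguished square induces a weak equivalence of quotients (`IsQuotient.weq_map`),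
so this is a functor from `T_n C'` to `wS_n C`. It is strictly simplicial because the chosen
quotient depends only on the cofibration (`quotT`).

In the other direction one keeps a row `A_{i,-}` of a diagram `A`: its quotients `A_{i,k}/A_{i,j}`
are again the `A_{j,k}`. No choice of row is compatible with all simplicial operators, and edgewise
subdivision repairs this. An `n`-simplex of `sd X` is a simplex of `X` on `[n] * [n]`, with two
inclusions `l ≤ r` of `[n]`. A chain of diagrams `A^•` over it gives the grid with entries
`A^{r(a)}_{l(a),r(b)}`. Increasing `b` gives cofibrations; increasing `a` gives a pushout square
followed by a square of weak equivalences, hence a distinguished square (`grid`, `sdGrid`).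
Composing with the map `|X| → |sd X|` yields `rowMap`.

Both composites are compared with the restriction to the second half of `[n] * [n]` (`sdLast`) by
natural transformations: the projections `F^{r(a)}(r(b)) → F^{r(a)}(r(b))/F^{r(a)}(l(a))`
(`projGrid`), and the isomorphisms from the quotients of a row to the given ones (`quotGrid`). The
restriction, precomposed with the subdivision, is homotopic to the identity by sliding all weight to
the second half (`exists_deformation`). Every homotopy is constant at the base point, so everything
passes to loop spaces.

The topology of realizations rests on one fact about simplices: two points are images, under
monotone maps, of one interior point of a third simplex (`exists_coupling`), and a monotone map is
determined by the image of an interior point (`eq_of_map_eq`). This gives the bijectivity needed to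
triangulate prisms and to subdivide simplices; compactness does the rest (`exists_inverse`). -/

lemma map_apply_eq_sum {X Y : Type*} [Fintype X] [Fintype Y] [DecidableEq Y] (f : X → Y)
    (s : stdSimplex ℝ X) (y : Y) : map f s y = ∑ x with f x = y, s x := by
  rw [map_coe, FunOnFinite.linearMap_apply_apply]

/-- A monotone map is determined by the pushforward of a measure with full support. -/
lemma eq_of_map_eq {m : ℕ} {L : Type*} [LinearOrder L] [Fintype L] {f g : Fin m → L}
    (hf : Monotone f) (hg : Monotone g) {z : stdSimplex ℝ (Fin m)} (hz : ∀ i, 0 < z i)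
    (h : map f z = map g z) : f = g := by
  have key : ∀ {f g : Fin m → L}, Monotone f → Monotone g → map f z = map g z →
      ∀ k, g k ≤ f k := by
    intro f g hf hg h k
    by_contra! hk
    have cum : ∀ e : Fin m → L, ∑ i with e i ≤ f k, z i = ∑ y with y ≤ f k, map e z y := by
      intro e
      simp_rw [map_apply_eq_sum]
      rw [← Finset.sum_fiberwise_of_maps_to (s := Finset.univ.filter fun i => e i ≤ f k)
        (t := Finset.univ.filter fun y => y ≤ f k) (g := e) (by simp)]
      refine Finset.sum_congr rfl fun y hy => Finset.sum_congr ?_ fun _ _ => rfl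
      ext i
      simp only [Finset.mem_filter, Finset.mem_univ, true_and] at hy ⊢
      exact ⟨fun h => h.2, fun h => ⟨h ▸ hy, h⟩⟩
    -- If `f k < g k`, every index with `g i ≤ f k` precedes `k` and so has `f i ≤ f k`, while `k`
    -- itself is only in the second set. Full support makes the inequality strict, but both masses
    -- are read off from the same pushforward.
    have hlt : ∑ i with g i ≤ f k, z i < ∑ i with f i ≤ f k, z i := by
      refine Finset.sum_lt_sum_of_subset (i := k) ?_ (by simp) (by simpa using hk) (hz k)
        (fun i _ _ => (hz i).le)
      intro i hi
      simp only [Finset.mem_filter, Finset.mem_univ, true_and] at hi ⊢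
      refine hf (le_of_not_gt fun hik => ?_)
      exact absurd (hg hik.le) (not_le_of_gt (lt_of_le_of_lt hi hk))
    rw [cum, cum, h] at hlt
    exact lt_irrefl _ hlt
  exact funext fun k => le_antisymm (key hg hf h.symm k) (key hf hg h k)

/-- The mass of the vertices before `i`. -/
noncomputable def cumul {p : ℕ} (s : stdSimplex ℝ (Fin p)) (i : ℕ) : ℝ :=
  ∑ k with k.val < i, s k

/-! ### Two measures as partitions of the unit interval, and their common refinement -/

section cumul

variable {p q : ℕ} (s : stdSimplex ℝ (Fin p)) (s' : stdSimplex ℝ (Fin q))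

lemma cumul_zero : cumul s 0 = 0 := by simp [cumul]

lemma cumul_last : cumul s p = 1 := by
  rw [cumul, Finset.filter_true_of_mem (fun k _ => k.isLt), sum_eq_one]

lemma cumul_mono : Monotone (cumul s) := fun i j hij =>
  Finset.sum_le_sum_of_subset_of_nonneg
    (fun k hk => by simp only [Finset.mem_filter, Finset.mem_univ, true_and] at hk ⊢; omega)
    (fun k _ _ => s.2.1 k)

lemma cumul_succ (i : Fin p) : cumul s (i + 1) = cumul s i + s i := by
  have : (Finset.univ.filter fun k : Fin p => k.val < i + 1) =
      insert i (Finset.univ.filter fun k : Fin p => k.val < i) := by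
    ext k; simp [Fin.ext_iff]; omega
  rw [cumul, this, Finset.sum_insert (by simp), add_comm]
  rfl

/-- The length of the intersection of the `i`-th interval for `s` and the `j`-th interval
for `s'`. -/
noncomputable def overlap (i j : ℕ) : ℝ :=
  max 0 (min (cumul s (i + 1)) (cumul s' (j + 1)) - max (cumul s i) (cumul s' j))

lemma overlap_symm (i j : ℕ) : overlap s s' i j = overlap s' s j i := by
  rw [overlap, overlap, min_comm, max_comm (cumul s i)]

/-- The intervals of `s'` tile `[0, 1]`, so they cut the `i`-th interval of `s` into pieces.
Clamping the endpoints to that interval turns the sum of the lengths into a telescoping one. -/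
lemma sum_overlap (i : Fin p) : ∑ j : Fin q, overlap s s' i j = s i := by
  have h : ∀ j : ℕ, overlap s s' i j =
      min (max (cumul s' (j + 1)) (cumul s i)) (cumul s (i + 1)) -
        min (max (cumul s' j) (cumul s i)) (cumul s (i + 1)) := by
    intro j
    have h1 := cumul_mono s (Nat.le_succ i)
    have h2 := cumul_mono s' (Nat.le_succ j)
    simp only [Nat.succ_eq_add_one] at h1 h2
    unfold overlap
    grind
  rw [Fin.sum_univ_eq_sum_range (fun j => overlap s s' i j)]
  simp_rw [h]
  rw [Finset.sum_range_sub (fun j => min (max (cumul s' j) (cumul s i)) (cumul s (i + 1))),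
    cumul_last, cumul_zero]
  have h0 := cumul_mono s (Nat.zero_le i)
  have h1 := cumul_mono s (Nat.succ_le_of_lt i.isLt)
  have h2 := cumul_mono s (Nat.le_succ i)
  have h3 := cumul_succ s i
  simp only [Nat.succ_eq_add_one, cumul_zero, cumul_last] at h0 h1 h2
  grind

/-- Two measures on finite linear orders are the pushforwards, along monotone maps, of one measure
with full support. -/
lemma exists_coupling {p q : ℕ} (s : stdSimplex ℝ (Fin (p + 1)))
    (s' : stdSimplex ℝ (Fin (q + 1))) :
    ∃ (m : ℕ) (f : Fin (m + 1) →o Fin (p + 1)) (g : Fin (m + 1) →o Fin (q + 1))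
      (z : stdSimplex ℝ (Fin (m + 1))), (∀ i, 0 < z i) ∧ map f z = s ∧ map g z = s' := by
  classical
  -- The coupling cuts `[0, 1]` at the breakpoints of both measures. Its atoms are the pieces of
  -- nonzero length, read from left to right, which is the lexicographic order on pairs of indices.
  let w : Fin (p + 1) ×ₗ Fin (q + 1) → ℝ := fun x => overlap s s' (ofLex x).1 (ofLex x).2
  have hw : ∀ x, 0 ≤ w x := fun x => le_max_left _ _
  let S : Finset (Fin (p + 1) ×ₗ Fin (q + 1)) := Finset.univ.filter fun x => w x ≠ 0
  have sum_fst : ∀ i, ∑ x ∈ S with (ofLex x).1 = i, w x = s i := by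
    intro i
    rw [← sum_overlap s s' i, Finset.filter_filter]
    rw [Finset.sum_subset (s₁ := Finset.univ.filter fun x => w x ≠ 0 ∧ (ofLex x).1 = i)
      (s₂ := Finset.univ.image fun j => toLex (i, j)) (f := w)]
    · rw [Finset.sum_image (by intro a _ b _ h; simpa using h)]
      rfl
    · intro x hx
      simp only [Finset.mem_filter, Finset.mem_univ, true_and] at hx
      simp only [Finset.mem_image, Finset.mem_univ, true_and]
      exact ⟨(ofLex x).2, by rw [← hx.2]; rfl⟩
    · intro x hx hx'
      simp only [Finset.mem_image, Finset.mem_univ, true_and, Finset.mem_filter] at hx hx'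
      obtain ⟨j, rfl⟩ := hx
      by_contra h
      exact hx' ⟨h, rfl⟩
  have sum_snd : ∀ j, ∑ x ∈ S with (ofLex x).2 = j, w x = s' j := by
    intro j
    rw [← sum_overlap s' s j, Finset.filter_filter]
    rw [Finset.sum_subset (s₁ := Finset.univ.filter fun x => w x ≠ 0 ∧ (ofLex x).2 = j)
      (s₂ := Finset.univ.image fun i => toLex (i, j)) (f := w)]
    · rw [Finset.sum_image (by intro a _ b _ h; simpa using h)]
      exact Finset.sum_congr rfl fun i _ => overlap_symm s s' _ _
    · intro x hx
      simp only [Finset.mem_filter, Finset.mem_univ, true_and] at hx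
      simp only [Finset.mem_image, Finset.mem_univ, true_and]
      exact ⟨(ofLex x).1, by rw [← hx.2]; rfl⟩
    · intro x hx hx'
      simp only [Finset.mem_image, Finset.mem_univ, true_and, Finset.mem_filter] at hx hx'
      obtain ⟨j, rfl⟩ := hx
      by_contra h
      exact hx' ⟨h, rfl⟩
  have sum_one : ∑ x ∈ S, w x = 1 := by
    rw [← sum_eq_one s, ← Finset.sum_fiberwise S (fun x => (ofLex x).1)]
    exact Finset.sum_congr rfl fun i _ => sum_fst i
  have hS : S.Nonempty := by
    rw [Finset.nonempty_iff_ne_empty]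
    rintro h
    simp [h] at sum_one
  obtain ⟨m, hm⟩ : ∃ m, S.card = m + 1 := ⟨S.card - 1, by have := hS.card_pos; omega⟩
  let e := S.orderEmbOfFin hm
  have heS : ∀ k, e k ∈ S := fun k => S.orderEmbOfFin_mem hm k
  have hpos : ∀ k, 0 < w (e k) := fun k =>
    lt_of_le_of_ne (hw _) (Ne.symm (Finset.mem_filter.1 (heS k)).2)
  have himg : Finset.univ.map e.toEmbedding = S := by
    rw [Finset.map_eq_image]; exact S.image_orderEmbOfFin_univ hm
  have hsum : ∀ P : Fin (p + 1) ×ₗ Fin (q + 1) → Prop, ∀ [DecidablePred P],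
      ∑ k with P (e k), w (e k) = ∑ x ∈ S with P x, w x := by
    intro P _
    rw [← himg, Finset.filter_map, Finset.sum_map]
    rfl
  have hsum' : ∑ k, w (e k) = ∑ x ∈ S, w x := by rw [← himg, Finset.sum_map]; rfl
  refine ⟨m, ⟨fun k => (ofLex (e k)).1, ?_⟩, ⟨fun k => (ofLex (e k)).2, ?_⟩,
    ⟨fun k => w (e k), fun k => (hpos k).le, hsum'.trans sum_one⟩, hpos, ?_, ?_⟩
  · intro k l hkl
    rcases Prod.Lex.le_iff.1 (e.monotone hkl) with h | h
    · exact h.le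
    · exact h.1.le
  · intro k l hkl
    rcases Prod.Lex.le_iff.1 (e.monotone hkl) with h | h
    -- If the first index increases and the second decreases, one piece lies to the left of the
    -- other according to `s` and to its right according to `s'`, which is impossible for pieces of
    -- positive length.
    · by_contra! h'
      have hk := hpos k
      have hl := hpos l
      have h1 := cumul_mono s (show ((ofLex (e k)).1 : ℕ) + 1 ≤ (ofLex (e l)).1 from h)
      have h2 := cumul_mono s' (show ((ofLex (e l)).2 : ℕ) + 1 ≤ (ofLex (e k)).2 from h')
      simp only [w, overlap, lt_max_iff, lt_irrefl, false_or, sub_pos, lt_min_iff,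
        max_lt_iff] at hk hl
      linarith [hk.1.2, hl.2.1]
    · exact h.2
  · ext i
    rw [map_apply_eq_sum]
    exact (hsum fun x => (ofLex x).1 = i).trans (sum_fst i)
  · ext j
    rw [map_apply_eq_sum]
    exact (hsum fun x => (ofLex x).2 = j).trans (sum_snd j)

end cumul

end stdSimplex

/-! ### Cells of a geometric realization -/

namespace Realization

variable {X Y : SSet.{u}}

/-- The characteristic map of a simplex. -/
noncomputable def cell {n : SimplexCategory} (x : X.obj (op n)) :
    C(stdSimplex ℝ (Fin (n.len + 1)), SSet.toTop.obj X) :=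
  TopCat.toSSetObjEquiv _ _ ((sSetTopAdj.unit.app X).app (op n) x)

lemma cell_map {m n : SimplexCategory} (θ : m ⟶ n) (x : X.obj (op n))
    (t : stdSimplex ℝ (Fin (m.len + 1))) :
    cell (X.map θ.op x) t = cell x (stdSimplex.map θ t) := by
  have h := ConcreteCategory.congr_hom ((sSetTopAdj.unit.app X).naturality θ.op) x
  have h' : (sSetTopAdj.unit.app X).app (op m) (X.map θ.op x) =
    (TopCat.toSSet.obj (SSet.toTop.obj X)).map θ.op ((sSetTopAdj.unit.app X).app (op n) x) := h
  rw [cell, h']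
  rfl

lemma toTop_map_cell (f : X ⟶ Y) {n : SimplexCategory} (x : X.obj (op n))
    (t : stdSimplex ℝ (Fin (n.len + 1))) :
    SSet.toTop.map f (cell x t) = cell (f.app _ x) t := by
  have h := ConcreteCategory.congr_hom (NatTrans.congr_app
    (sSetTopAdj.unit.naturality f) (op n)) x
  have h' : (sSetTopAdj.unit.app Y).app (op n) (f.app _ x) =
    (TopCat.toSSet.map (SSet.toTop.map f)).app (op n) ((sSetTopAdj.unit.app X).app (op n) x) := h
  rw [cell, cell, h']
  rfl

/-! ### Maps out of a realization, given cell by cell -/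

section lift

variable {Z : Type u} [TopologicalSpace Z]
  (F : ∀ {n : SimplexCategory}, X.obj (op n) → C(stdSimplex ℝ (Fin (n.len + 1)), Z))
  (hF : ∀ {m n : SimplexCategory} (θ : m ⟶ n) (x : X.obj (op n)) t,
    F (X.map θ.op x) t = F x (stdSimplex.map θ t))

/-- The morphism to the singular simplicial set corresponding to a compatible family of maps. -/
noncomputable def toSingular : X ⟶ TopCat.toSSet.obj (TopCat.of Z) where
  app n := TypeCat.ofHom fun x => (TopCat.toSSetObjEquiv (TopCat.of Z) n).symm (F x)
  naturality m n θ := by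
    ext x
    apply (TopCat.toSSetObjEquiv (TopCat.of Z) n).injective
    ext t
    exact hF θ.unop x t

/-- A map out of a realization, given by a compatible family of maps on simplices. -/
noncomputable def lift : C(SSet.toTop.obj X, Z) :=
  ((sSetTopAdj.homEquiv X (TopCat.of Z)).symm (toSingular F hF)).hom

lemma lift_cell {n : SimplexCategory} (x : X.obj (op n)) (t) : lift F hF (cell x t) = F x t := by
  have h := (sSetTopAdj.homEquiv X (TopCat.of Z)).apply_symm_apply (toSingular F hF)
  rw [Adjunction.homEquiv_unit] at h
  have h' := ConcreteCategory.congr_hom (NatTrans.congr_app h (op n)) x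
  exact DFunLike.congr_fun (congrArg (TopCat.toSSetObjEquiv (TopCat.of Z) (op n)) h') t

end lift

/-- Every point of a realization lies on a cell. -/
lemma exists_cell (a : SSet.toTop.obj X) :
    ∃ (n : SimplexCategory) (x : X.obj (op n)) (t : _), cell x t = a := by
  -- For the indiscrete topology every predicate is continuous. "Lies on a cell" and "true" are then
  -- two maps out of the realization that agree on all cells, so the adjunction makes them equal.
  let : TopologicalSpace (ULift.{u} Prop) := ⊤
  let R : SSet.toTop.obj X → ULift.{u} Prop :=
    fun a => ⟨∃ (n : SimplexCategory) (x : X.obj (op n)) (t : _), cell x t = a⟩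
  let f : SSet.toTop.obj X ⟶ TopCat.of (ULift.{u} Prop) := TopCat.ofHom ⟨R, continuous_top⟩
  let g : SSet.toTop.obj X ⟶ TopCat.of (ULift.{u} Prop) :=
    TopCat.ofHom ⟨fun _ => ⟨True⟩, continuous_top⟩
  have h : f = g := by
    apply (sSetTopAdj.homEquiv X _).injective
    rw [Adjunction.homEquiv_unit, Adjunction.homEquiv_unit]
    ext n x
    apply (TopCat.toSSetObjEquiv _ n).injective
    ext t : 1
    change R (cell x t) = ⟨True⟩
    simp only [R, ULift.up.injEq, eq_iff_iff, iff_true]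
    exact ⟨_, x, t, rfl⟩
  have := congrArg ULift.down (ConcreteCategory.congr_hom h a)
  exact (iff_of_eq this).2 trivial

/-- Every cell factors through that of a nondegenerate simplex, so finitely many compact images
cover the realization. -/
instance [X.Finite] : CompactSpace (SSet.toTop.obj X) := by
  have : Set.univ = ⋃ x : X.N, Set.range (cell x.simplex) := by
    symm
    rw [Set.eq_univ_iff_forall]
    intro a
    obtain ⟨n, x, t, rfl⟩ := exists_cell a
    induction n using SimplexCategory.rec with | _ n
    obtain ⟨m, f, hf, y, rfl⟩ := X.exists_nonDegenerate x
    rw [Set.mem_iUnion]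
    exact ⟨SSet.N.mk _ y.2, stdSimplex.map f t, (cell_map f _ t).symm⟩
  refine ⟨?_⟩
  rw [this]
  exact isCompact_iUnion fun x => isCompact_range (cell x.simplex).continuous

/-- A compatible family of maps from the simplices of a finite simplicial set to a Hausdorff space
that is bijective on cells has a continuous inverse. -/
lemma exists_inverse [X.Finite] {Z : Type} [TopologicalSpace Z] [T2Space Z]
    (F : ∀ {n : SimplexCategory}, X.obj (op n) → C(stdSimplex ℝ (Fin (n.len + 1)), Z))
    (hF : ∀ {m n : SimplexCategory} (θ : m ⟶ n) (x : X.obj (op n)) t,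
      F (X.map θ.op x) t = F x (stdSimplex.map θ t))
    (surj : ∀ a : Z, ∃ (n : SimplexCategory) (x : X.obj (op n)) (t : _), F x t = a)
    (inj : ∀ {m n : SimplexCategory} (x : X.obj (op m)) (y : X.obj (op n)) t t',
      F x t = F y t' → cell x t = cell y t') :
    ∃ G : C(Z, SSet.toTop.obj X), ∀ {n : SimplexCategory} (x : X.obj (op n)) t,
      G (F x t) = cell x t := by
  -- The glued map is a continuous bijection from a compact space to a Hausdorff one, hence a
  -- homeomorphism; `ULift` only adjusts universes.
  let L : C(SSet.toTop.obj X, ULift.{u} Z) :=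
    lift (fun x => ⟨fun t => ⟨F x t⟩, by fun_prop⟩) (fun θ x t => congrArg ULift.up (hF θ x t))
  have hL : ∀ {n : SimplexCategory} (x : X.obj (op n)) t, L (cell x t) = ⟨F x t⟩ :=
    fun x t => lift_cell _ _ x t
  have hinj : Function.Injective L := by
    intro a b hab
    obtain ⟨m, x, t, rfl⟩ := exists_cell a
    obtain ⟨n, y, t', rfl⟩ := exists_cell b
    rw [hL, hL] at hab
    exact inj x y t t' (ULift.up_injective hab)
  have hsurj : Function.Surjective L := by
    rintro ⟨a⟩
    obtain ⟨n, x, t, rfl⟩ := surj a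
    exact ⟨_, hL x t⟩
  let e := L.continuous.homeoOfEquivCompactToT2 (f := Equiv.ofBijective L ⟨hinj, hsurj⟩)
  refine ⟨⟨fun a => e.symm ⟨a⟩, by fun_prop⟩, fun x t => ?_⟩
  rw [ContinuousMap.coe_mk, Homeomorph.symm_apply_eq]
  exact (hL x t).symm

end Realization

/-! ### Convex combinations in topological simplices -/

namespace stdSimplex

section combo

variable {X Y : Type*} [Fintype X] [Fintype Y]

/-- The point `(1 - a) x + a y`. -/
noncomputable def combo (a : unitInterval) (x y : stdSimplex ℝ X) : stdSimplex ℝ X :=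
  ⟨(1 - (a : ℝ)) • x.1 + (a : ℝ) • y.1,
    convex_stdSimplex ℝ X x.2 y.2 (sub_nonneg.2 a.2.2) a.2.1 (by ring)⟩

lemma combo_apply (a : unitInterval) (x y : stdSimplex ℝ X) (i : X) :
    combo a x y i = (1 - (a : ℝ)) * x i + a * y i := rfl

lemma map_combo (f : X → Y) (a : unitInterval) (x y : stdSimplex ℝ X) :
    map f (combo a x y) = combo a (map f x) (map f y) := by
  classical
  ext j
  simp only [combo_apply, map_apply_eq_sum, Finset.mul_sum, ← Finset.sum_add_distrib]

lemma combo_one (x y : stdSimplex ℝ X) : combo 1 x y = y := by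
  ext i
  simp [combo_apply]

lemma continuous_combo :
    Continuous fun q : unitInterval × stdSimplex ℝ X × stdSimplex ℝ X =>
      combo q.1 q.2.1 q.2.2 :=
  Continuous.subtype_mk (by fun_prop) _

lemma map_apply_of_injective [DecidableEq Y] {f : X → Y} (hf : Function.Injective f)
    (x : stdSimplex ℝ X) (i : X) : map f x (f i) = x i := by
  classical
  rw [map_apply_eq_sum, Finset.sum_eq_single i]
  · intro j hj hji
    exact absurd (hf (Finset.mem_filter.1 hj).2) hji
  · simp

lemma le_map_apply (f : X → Y) (x : stdSimplex ℝ X) (i : X) : x i ≤ map f x (f i) := by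
  classical
  rw [map_apply_eq_sum]
  exact Finset.single_le_sum (f := fun j => x j) (fun j _ => x.2.1 j) (by simp)

end combo

end stdSimplex

/-- The midpoint of the unit interval. -/
noncomputable def unitInterval.mid : unitInterval := ⟨1 / 2, by norm_num, by norm_num⟩

/-! ### The edgewise subdivision -/

namespace SimplexCategory

/-- The ordinal `[n] * [n]`. -/
def double (n : SimplexCategory) : SimplexCategory := ⦋n.len + 1 + n.len⦌

/-- The first inclusion `[n] ⟶ [n] * [n]`. -/
def inl (n : SimplexCategory) : n ⟶ n.double :=
  Hom.mk ⟨fun i => Fin.castAdd (n.len + 1) i, fun _ _ h => h⟩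

/-- The second inclusion `[n] ⟶ [n] * [n]`. -/
def inr (n : SimplexCategory) : n ⟶ n.double :=
  Hom.mk ⟨fun i => Fin.natAdd (n.len + 1) i, fun _ _ h => Nat.add_le_add_left h _⟩

@[elab_as_elim]
lemma double_cases {n : SimplexCategory} {P : Fin (n.double.len + 1) → Prop}
    (inl : ∀ i, P (n.inl i)) (inr : ∀ i, P (n.inr i)) (i) : P i :=
  Fin.addCases (m := n.len + 1) (n := n.len + 1) (motive := P) inl inr i

lemma inl_le_inr {n : SimplexCategory} (i j : Fin (n.len + 1)) : n.inl i ≤ n.inr j := by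
  change i.val ≤ n.len + 1 + j.val
  omega

/-- The function on `[m] * [m]` with given restrictions. -/
def copairFun {m n : SimplexCategory} (f g : m ⟶ n) (i : Fin (m.double.len + 1)) :
    Fin (n.len + 1) :=
  Fin.addCases (m := m.len + 1) (n := m.len + 1) (motive := fun _ => Fin (n.len + 1))
    (fun i => f i) (fun i => g i) i

lemma copairFun_inl {m n : SimplexCategory} (f g : m ⟶ n) (i : Fin (m.len + 1)) :
    copairFun f g (m.inl i) = f i :=
  Fin.addCases_left (motive := fun _ => Fin (n.len + 1)) i

lemma copairFun_inr {m n : SimplexCategory} (f g : m ⟶ n) (i : Fin (m.len + 1)) :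
    copairFun f g (m.inr i) = g i :=
  Fin.addCases_right (motive := fun _ => Fin (n.len + 1)) i

/-- The map out of `[m] * [m]` with given restrictions. -/
def copair {m n : SimplexCategory} (f g : m ⟶ n) (h : ∀ i j, f i ≤ g j) : m.double ⟶ n :=
  Hom.mk ⟨copairFun f g, by
      intro i j
      induction i using double_cases <;> induction j using double_cases <;> rename_i i j <;>
        intro hij <;> simp only [copairFun_inl, copairFun_inr]
      · exact f.toOrderHom.monotone hij
      · exact h i j
      · exact absurd hij (not_le_of_gt (Nat.lt_add_right _ j.isLt))
      · exact g.toOrderHom.monotone (Nat.le_of_add_le_add_left hij)⟩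

section copair

variable {m n k : SimplexCategory} (f g : m ⟶ n) (h : ∀ i j, f i ≤ g j)

@[simp]
lemma inl_copair : m.inl ≫ copair f g h = f := by
  ext i : 3
  exact copairFun_inl f g i

@[simp]
lemma inr_copair : m.inr ≫ copair f g h = g := by
  ext i : 3
  exact copairFun_inr f g i

lemma double_hom_ext {f g : m.double ⟶ n} (hl : m.inl ≫ f = m.inl ≫ g)
    (hr : m.inr ≫ f = m.inr ≫ g) : f = g := by
  ext i : 3
  exact double_cases (P := fun i => f i = g i) (fun i => ConcreteCategory.congr_hom hl i)
    (fun i => ConcreteCategory.congr_hom hr i) i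

end copair

/-- The map `θ * θ`. -/
def doubleMap {m n : SimplexCategory} (θ : m ⟶ n) : m.double ⟶ n.double :=
  copair (θ ≫ inl _) (θ ≫ inr _) fun i j => inl_le_inr (θ i) (θ j)

lemma inl_doubleMap {m n : SimplexCategory} (θ : m ⟶ n) :
    m.inl ≫ doubleMap θ = θ ≫ n.inl := inl_copair _ _ _

lemma inr_doubleMap {m n : SimplexCategory} (θ : m ⟶ n) :
    m.inr ≫ doubleMap θ = θ ≫ n.inr := inr_copair _ _ _

/-- The functor `[n] ↦ [n] * [n]`. -/
def doubleFunctor : SimplexCategory ⥤ SimplexCategory where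
  obj n := n.double
  map θ := doubleMap θ
  map_id n := double_hom_ext
    (by rw [inl_doubleMap, Category.id_comp, Category.comp_id])
    (by rw [inr_doubleMap, Category.id_comp, Category.comp_id])
  map_comp f g := double_hom_ext
    (by rw [inl_doubleMap, ← Category.assoc, inl_doubleMap, Category.assoc, Category.assoc,
      inl_doubleMap])
    (by rw [inr_doubleMap, ← Category.assoc, inr_doubleMap, Category.assoc, Category.assoc,
      inr_doubleMap])

lemma map_map {m n k : SimplexCategory} (f : m ⟶ n) (g : n ⟶ k)
    (t : stdSimplex ℝ (Fin (m.len + 1))) :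
    stdSimplex.map g (stdSimplex.map f t) = stdSimplex.map (f ≫ g) t :=
  stdSimplex.map_comp_apply _ _ _

/-- The point of the simplex on `[n] * [n]` with weight `1 - a` on the first copy of `t` and
weight `a` on the second one. -/
noncomputable def spread {n : SimplexCategory} (a : unitInterval)
    (t : stdSimplex ℝ (Fin (n.len + 1))) : stdSimplex ℝ (Fin (n.double.len + 1)) :=
  stdSimplex.combo a (stdSimplex.map n.inl t) (stdSimplex.map n.inr t)

lemma map_spread {m n : SimplexCategory} (y : m.double ⟶ n) (a : unitInterval)
    (t : stdSimplex ℝ (Fin (m.len + 1))) :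
    stdSimplex.map y (spread a t) =
      stdSimplex.combo a (stdSimplex.map (m.inl ≫ y) t) (stdSimplex.map (m.inr ≫ y) t) := by
  rw [spread, stdSimplex.map_combo, map_map, map_map]

lemma spread_map {m n : SimplexCategory} (θ : m ⟶ n) (a : unitInterval)
    (t : stdSimplex ℝ (Fin (m.len + 1))) :
    spread a (stdSimplex.map θ t) = stdSimplex.map (doubleMap θ) (spread a t) := by
  rw [map_spread, inl_doubleMap, inr_doubleMap, spread, map_map, map_map]

lemma continuous_spread {n : SimplexCategory} :
    Continuous fun q : unitInterval × stdSimplex ℝ (Fin (n.len + 1)) => spread q.1 q.2 :=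
  stdSimplex.continuous_combo.comp (continuous_fst.prodMk
    (((stdSimplex.continuous_map _).comp continuous_snd).prodMk
      ((stdSimplex.continuous_map _).comp continuous_snd)))

/-- Each copy of a vertex keeps half of its weight. Interior points thus stay interior, and
`hom_eq_of_map_eq` applies to them. -/
lemma spread_pos {n : SimplexCategory} {t : stdSimplex ℝ (Fin (n.len + 1))} (ht : ∀ i, 0 < t i)
    (i) : 0 < spread unitInterval.mid t i := by
  have hl : Function.Injective n.inl := fun i j h => Fin.castAdd_injective _ _ h
  have hr : Function.Injective n.inr := fun i j h => Fin.natAdd_injective _ _ h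
  have h0 : ∀ (f : n ⟶ n.double) j, 0 ≤ stdSimplex.map f t j := fun f j =>
    (stdSimplex.map f t).2.1 j
  have hmid : (unitInterval.mid : ℝ) = 1 / 2 := rfl
  induction i using double_cases <;> rename_i i <;> rw [spread, stdSimplex.combo_apply, hmid]
  · have := stdSimplex.map_apply_of_injective hl t i
    linarith [ht i, h0 n.inr (n.inl i)]
  · have := stdSimplex.map_apply_of_injective hr t i
    linarith [ht i, h0 n.inl (n.inr i)]

lemma exists_coupling {p q : SimplexCategory} (s : stdSimplex ℝ (Fin (p.len + 1)))
    (s' : stdSimplex ℝ (Fin (q.len + 1))) :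
    ∃ (m : SimplexCategory) (f : m ⟶ p) (g : m ⟶ q) (z : stdSimplex ℝ (Fin (m.len + 1))),
      (∀ i, 0 < z i) ∧ stdSimplex.map f z = s ∧ stdSimplex.map g z = s' := by
  obtain ⟨m, f, g, z, hz, hf, hg⟩ := stdSimplex.exists_coupling s s'
  exact ⟨⦋m⦌, Hom.mk f, Hom.mk g, z, hz, hf, hg⟩

lemma hom_eq_of_map_eq {m n : SimplexCategory} {f g : m ⟶ n}
    {z : stdSimplex ℝ (Fin (m.len + 1))} (hz : ∀ i, 0 < z i)
    (h : stdSimplex.map f z = stdSimplex.map g z) : f = g := by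
  ext i : 3
  exact congrFun (stdSimplex.eq_of_map_eq f.toOrderHom.monotone g.toOrderHom.monotone hz h) i

/-- Cut the unit interval, partitioned according to `t`, at `1/2`. The two halves, rescaled to
probability measures, are images of a common `w` under monotone maps `a` and `b`; since `a ≤ b`,
these assemble to a map out of `[m] * [m]`, and `t` is the midpoint of the two images. -/
lemma exists_map_spread {n : SimplexCategory} (t : stdSimplex ℝ (Fin (n.len + 1))) :
    ∃ (m : SimplexCategory) (y : m.double ⟶ n) (z : stdSimplex ℝ (Fin (m.len + 1))),
      stdSimplex.map y (spread unitInterval.mid z) = t := by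
  obtain ⟨M, f, g, z, hz, rfl, hg⟩ := exists_coupling (q := ⦋1⦌) t
    (stdSimplexHomeomorphUnitInterval.symm unitInterval.mid)
  have hsum : ∀ j : Fin 2, ∑ k with g k = j, z k = 1 / 2 := by
    intro j
    have := DFunLike.congr_fun hg j
    rw [stdSimplex.map_apply_eq_sum] at this
    refine this.trans ?_
    fin_cases j
    · change (1 : ℝ) - 1 / 2 = 1 / 2
      norm_num
    · rfl
  -- Each half has mass `1/2`; the factor 2 normalizes it.
  let part (j : Fin 2) : stdSimplex ℝ (Fin (M.len + 1)) :=
    ⟨fun k => if g k = j then 2 * z k else 0, fun k => by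
      have := hz k
      dsimp only
      split_ifs <;> linarith, by
      rw [← Finset.sum_filter, ← Finset.mul_sum, hsum]
      norm_num⟩
  have hpart : stdSimplex.combo unitInterval.mid (part 0) (part 1) = z := by
    ext k
    have hmid : (unitInterval.mid : ℝ) = 1 / 2 := rfl
    rw [stdSimplex.combo_apply, hmid]
    change (1 - 1 / 2) * (if g k = (0 : Fin 2) then 2 * z k else 0) +
      1 / 2 * (if g k = (1 : Fin 2) then 2 * z k else 0) = z k
    have h01 : g k = (0 : Fin 2) ∨ g k = (1 : Fin 2) := by
      generalize g k = j
      change Fin 2 at j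
      fin_cases j <;> simp
    rcases h01 with h | h <;> rw [h] <;> norm_num <;> ring
  obtain ⟨m, a, b, w, hw, ha, hb⟩ := exists_coupling (part 0) (part 1)
  have hmem : ∀ (c : m ⟶ M) (j : Fin 2), stdSimplex.map c w = part j → ∀ i, g (c i) = j := by
    intro c j hc i
    by_contra hne
    have h := stdSimplex.le_map_apply c w i
    rw [hc] at h
    have h' : part j (c i) = 0 := if_neg hne
    linarith [hw i]
  -- The values of `a` lie over `0` and those of `b` over `1` in `[1]`, and `g` is monotone.
  have hab : ∀ i j, a i ≤ b j := by
    intro i j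
    by_contra! hlt
    have := g.toOrderHom.monotone hlt.le
    have h2 : g (b j) ≤ g (a i) := this
    rw [hmem a 0 ha, hmem b 1 hb] at h2
    exact absurd h2 (by decide)
  refine ⟨m, copair a b hab ≫ f, w, ?_⟩
  rw [← map_map, map_spread, inl_copair, inr_copair, ha, hb, hpart]

end SimplexCategory

namespace Realization

open SimplexCategory

/-- The edgewise subdivision of a simplicial set. -/
abbrev sd (X : SSet.{u}) : SSet.{u} := doubleFunctor.op ⋙ X

/-- The functoriality of the edgewise subdivision. -/
abbrev sdMap {X Y : SSet.{u}} (f : X ⟶ Y) : sd X ⟶ sd Y := Functor.whiskerLeft _ f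

/-- The restriction to the second half. -/
def sdLast (X : SSet.{u}) : sd X ⟶ X where
  app n := X.map n.unop.inr.op
  naturality m n θ := by
    change X.map (doubleMap θ.unop).op ≫ X.map n.unop.inr.op = X.map m.unop.inr.op ≫ X.map θ.unop.op
    rw [← X.map_comp, ← X.map_comp, ← op_comp, ← op_comp, inr_doubleMap]

/-- The restriction to the first half. -/
def sdFirst (X : SSet.{u}) : sd X ⟶ X where
  app n := X.map n.unop.inl.op
  naturality m n θ := by
    change X.map (doubleMap θ.unop).op ≫ X.map n.unop.inl.op = X.map m.unop.inl.op ≫ X.map θ.unop.op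
    rw [← X.map_comp, ← X.map_comp, ← op_comp, ← op_comp, inl_doubleMap]

end Realization

/-! ### Comparison of `|X|` with `|sd X|`, and the deformation to the second half -/

namespace Realization

open SimplexCategory MonoidalCategory

variable {X Y : SSet.{u}}

/-- The characteristic map of a simplex of the subdivision. -/
noncomputable def sdCell {n : SimplexCategory} (z : X.obj (op n.double)) :
    C(stdSimplex ℝ (Fin (n.len + 1)), SSet.toTop.obj (sd X)) :=
  cell (X := sd X) (n := n) z

lemma toTop_map_sdMap_sdCell (f : X ⟶ Y) {n : SimplexCategory} (z : X.obj (op n.double)) (t) :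
    SSet.toTop.map (sdMap f) (sdCell z t) = sdCell (f.app _ z) t :=
  toTop_map_cell (sdMap f) (n := n) z t

lemma toTop_map_sdLast_sdCell {n : SimplexCategory} (z : X.obj (op n.double)) (t) :
    SSet.toTop.map (sdLast X) (sdCell z t) = cell (X.map n.inr.op z) t :=
  toTop_map_cell (sdLast X) (n := n) z t

/-- Restricting to the two halves embeds the subdivision of `Δ[n]` in the finite simplicial set
`Δ[n] × Δ[n]`. -/
instance finite_sd_stdSimplex (n : SimplexCategory) :
    SSet.Finite (sd (SSet.stdSimplex.{u}.obj n)) := by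
  let f : sd (SSet.stdSimplex.{u}.obj n) ⟶ SSet.stdSimplex.obj n ⊗ SSet.stdSimplex.obj n :=
    CartesianMonoidalCategory.lift (sdFirst _) (sdLast _)
  have : Mono f := by
    rw [NatTrans.mono_iff_mono_app]
    intro m
    rw [CategoryTheory.mono_iff_injective]
    intro y y' h
    have hl := congrArg (fun q => SSet.stdSimplex.objEquiv (Prod.fst q)) h
    have hr := congrArg (fun q => SSet.stdSimplex.objEquiv (Prod.snd q)) h
    exact SSet.stdSimplex.objEquiv.injective (double_hom_ext (m := m.unop) hl hr)
  have : SSet.Finite (SSet.stdSimplex.{u}.obj n) := by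
    induction n using SimplexCategory.rec with | _ n
    infer_instance
  exact SSet.finite_of_mono f

/-- This is the injectivity behind the subdivision of a simplex: if two cells meet in a point, then
after pulling back to a common interior point the two simplices coincide. -/
lemma doubleMap_comp_eq {k l m n : SimplexCategory} {f : l ⟶ k} {g : l ⟶ m} {y : k.double ⟶ n}
    {y' : m.double ⟶ n} {z : stdSimplex ℝ (Fin (l.len + 1))} (hz : ∀ i, 0 < z i)
    (h : stdSimplex.map y (spread unitInterval.mid (stdSimplex.map f z)) =
      stdSimplex.map y' (spread unitInterval.mid (stdSimplex.map g z))) :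
    doubleMap f ≫ y = doubleMap g ≫ y' := by
  rw [spread_map, spread_map, map_map, map_map] at h
  exact hom_eq_of_map_eq (spread_pos hz) h

/-- The subdivision of a topological simplex. -/
lemma exists_subdivide (n : SimplexCategory) :
    ∃ G : C(stdSimplex ℝ (Fin (n.len + 1)), SSet.toTop.obj (sd (SSet.stdSimplex.{u}.obj n))),
      ∀ {m : SimplexCategory} (y : m.double ⟶ n) (t : stdSimplex ℝ (Fin (m.len + 1))),
        G (stdSimplex.map y (spread unitInterval.mid t)) =
          sdCell (SSet.stdSimplex.objEquiv.symm y) t := by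
  obtain ⟨G, hG⟩ := exists_inverse (X := sd (SSet.stdSimplex.{u}.obj n))
    (Z := stdSimplex ℝ (Fin (n.len + 1)))
    (fun {m} y => ⟨fun t => stdSimplex.map (SSet.stdSimplex.objEquiv y)
      (spread (n := m) unitInterval.mid t), (stdSimplex.continuous_map _).comp
        (continuous_spread.comp (continuous_const.prodMk continuous_id))⟩)
    (fun {k m} θ y t => by
      refine Eq.symm ?_
      refine (congrArg (stdSimplex.map (SSet.stdSimplex.objEquiv y)) (spread_map θ _ t)).trans ?_
      exact map_map (doubleMap θ) (SSet.stdSimplex.objEquiv y) _)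
    (fun t => by
      obtain ⟨m, y, z, h⟩ := exists_map_spread t
      exact ⟨m, SSet.stdSimplex.objEquiv.symm y, z, h⟩)
    (fun {k m} y y' t t' h => by
      obtain ⟨l, f, g, z, hz, rfl, rfl⟩ := exists_coupling t t'
      rw [← cell_map, ← cell_map]
      refine congrArg (fun w => cell w z) ?_
      exact SSet.stdSimplex.objEquiv.injective (doubleMap_comp_eq hz h))
  exact ⟨G, fun {m} y t => hG (n := m) (SSet.stdSimplex.objEquiv.symm y) t⟩

/-- Every point of a realization lies on the cell of a simplex of the subdivision. -/
lemma exists_cell_spread (a : SSet.toTop.obj X) :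
    ∃ (n : SimplexCategory) (z : X.obj (op n.double)) (t : stdSimplex ℝ (Fin (n.len + 1))),
      cell z (spread unitInterval.mid t) = a := by
  obtain ⟨n, x, t, rfl⟩ := exists_cell a
  obtain ⟨m, y, z, rfl⟩ := exists_map_spread t
  exact ⟨m, X.map y.op x, z, cell_map _ _ _⟩

/-- The identification of a realization with the realization of the edgewise subdivision. -/
lemma exists_subdivision (X : SSet.{u}) :
    ∃ G : C(SSet.toTop.obj X, SSet.toTop.obj (sd X)),
      ∀ {n : SimplexCategory} (z : X.obj (op n.double)) (t : stdSimplex ℝ (Fin (n.len + 1))),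
        G (cell z (spread unitInterval.mid t)) = sdCell z t := by
  choose G hG using exists_subdivide.{u}
  have key : ∀ {n m : SimplexCategory} (x : X.obj (op n)) (y : m.double ⟶ n)
      (t : stdSimplex ℝ (Fin (m.len + 1))),
      SSet.toTop.map (sdMap (SSet.yonedaEquiv.symm x))
        (G n (stdSimplex.map y (spread unitInterval.mid t))) =
      sdCell (X.map y.op x) t := by
    intro n m x y t
    rw [hG]
    exact toTop_map_sdMap_sdCell _ _ _
  -- On the cell of `x`, transport the subdivision of the topological simplex along the map `Δ[n] ⟶
  -- X` classifying `x`.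
  let F : ∀ {n : SimplexCategory}, X.obj (op n) →
      C(stdSimplex ℝ (Fin (n.len + 1)), SSet.toTop.obj (sd X)) := fun {n} x =>
    (SSet.toTop.map (sdMap (SSet.yonedaEquiv.symm x))).hom.comp (G n)
  refine ⟨lift F ?_, fun {n} z t => ?_⟩
  · intro m n θ x t
    -- The subdivision is only specified on images of midpoints, which are all points.
    obtain ⟨k, y, z, rfl⟩ := exists_map_spread t
    refine (key _ y z).trans ?_
    rw [map_map]
    refine Eq.trans ?_ (key x (y ≫ θ) z).symm
    rw [op_comp, X.map_comp]
    rfl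
  · rw [lift_cell]
    refine Eq.trans ?_ ((key z (𝟙 _) t).trans ?_)
    · change _ = SSet.toTop.map _ (G _ (stdSimplex.map id _))
      rw [stdSimplex.map_id_apply]
      rfl
    · rw [op_id, X.map_id]
      rfl

/-- The identification of a realization with the realization of the edgewise subdivision. -/
noncomputable def subdivision (X : SSet.{u}) : C(SSet.toTop.obj X, SSet.toTop.obj (sd X)) :=
  (exists_subdivision X).choose

lemma subdivision_cell {n : SimplexCategory} (z : X.obj (op n.double))
    (t : stdSimplex ℝ (Fin (n.len + 1))) :
    subdivision X (cell z (spread unitInterval.mid t)) = sdCell z t :=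
  (exists_subdivision X).choose_spec z t

lemma subdivision_naturality (f : X ⟶ Y) (a : SSet.toTop.obj X) :
    subdivision Y (SSet.toTop.map f a) = SSet.toTop.map (sdMap f) (subdivision X a) := by
  obtain ⟨n, z, t, rfl⟩ := exists_cell_spread a
  rw [toTop_map_cell, subdivision_cell, subdivision_cell, toTop_map_sdMap_sdCell]

instance : Unique (stdSimplex ℝ (Fin ((op ⦋0⦌).unop.len + 1))) :=
  inferInstanceAs (Unique (stdSimplex ℝ (Fin 1)))

lemma vertexPoint_eq_cell (x : X.obj (op ⦋0⦌)) (t) : SSet.vertexPoint X x = cell x t := by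
  rw [Subsingleton.elim t default]
  rfl

lemma toTop_map_vertexPoint (f : X ⟶ Y) (x : X.obj (op ⦋0⦌)) :
    SSet.toTop.map f (SSet.vertexPoint X x) = SSet.vertexPoint Y (f.app _ x) := by
  rw [vertexPoint_eq_cell x default, toTop_map_cell, vertexPoint_eq_cell _ default]

lemma cell_degenerate (x : X.obj (op ⦋0⦌)) {n : SimplexCategory} (θ : n ⟶ ⦋0⦌) (t) :
    cell (X.map θ.op x) t = SSet.vertexPoint X x := by
  rw [cell_map, ← vertexPoint_eq_cell]

lemma subdivision_vertexPoint (x : X.obj (op ⦋0⦌)) :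
    subdivision X (SSet.vertexPoint X x) = SSet.vertexPoint (sd X)
      (X.map (SimplexCategory.const (double ⦋0⦌) ⦋0⦌ 0).op x) := by
  refine Eq.trans ?_ (vertexPoint_eq_cell (X := sd X) _ default).symm
  refine Eq.trans ?_ (subdivision_cell (n := ⦋0⦌) _ default)
  rw [cell_degenerate]

/-- The deformation of the identity to the restriction to the second half. -/
lemma exists_deformation (X : SSet.{u}) :
    ∃ H : C(SSet.toTop.obj X, C(unitInterval, SSet.toTop.obj X)),
      (∀ a, H a 0 = a) ∧ (∀ a, H a 1 = SSet.toTop.map (sdLast X) (subdivision X a)) ∧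
      ∀ x s, H (SSet.vertexPoint X x) s = SSet.vertexPoint X x := by
  -- The weight on the second copy runs from `1/2`, where the point is the original one, to `1`,
  -- where only the second half is left.
  let half : C(unitInterval, unitInterval) :=
    ⟨fun s => ⟨(1 + s) / 2, by linarith [s.2.1], by linarith [s.2.2]⟩, by fun_prop⟩
  -- Taking values in paths lets the homotopy be glued over cells, without comparing `|X| × I` with
  -- a realization.
  let F : ∀ {n : SimplexCategory}, (sd X).obj (op n) →
      C(stdSimplex ℝ (Fin (n.len + 1)), C(unitInterval, SSet.toTop.obj X)) := fun {n} z =>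
    ContinuousMap.curry ⟨fun q => cell (X := X) (n := n.double) z (spread (half q.2) q.1),
      (cell (X := X) (n := n.double) z).continuous.comp (continuous_spread.comp
        ((half.continuous.comp continuous_snd).prodMk continuous_fst))⟩
  have hF : ∀ {m n : SimplexCategory} (θ : m ⟶ n) (z : (sd X).obj (op n)) t,
      F ((sd X).map θ.op z) t = F z (stdSimplex.map θ t) := by
    intro m n θ z t
    ext s
    refine (cell_map (X := X) (doubleMap θ) z (spread (half s) t)).trans ?_
    rw [← spread_map]
    rfl
  have key : ∀ {n : SimplexCategory} (z : X.obj (op n.double)) t s,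
      (lift F hF).comp (subdivision X) (cell z (spread unitInterval.mid t)) s =
        cell (X := X) z (spread (half s) t) := by
    intro n z t s
    rw [ContinuousMap.comp_apply, subdivision_cell]
    exact DFunLike.congr_fun (lift_cell F hF (n := n) z t) s
  refine ⟨(lift F hF).comp (subdivision X), fun a => ?_, fun a => ?_, fun x s => ?_⟩
  · obtain ⟨n, z, t, rfl⟩ := exists_cell_spread a
    rw [key]
    congr 2
    ext
    simp [half, unitInterval.mid]
  · obtain ⟨n, z, t, rfl⟩ := exists_cell_spread a
    have h1 : half 1 = 1 := by ext; simp [half]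
    rw [key, h1, subdivision_cell, toTop_map_sdLast_sdCell, spread, stdSimplex.combo_one,
      cell_map]
  · have h : cell (X.map (SimplexCategory.const (double ⦋0⦌) ⦋0⦌ 0).op x)
        (spread (n := ⦋0⦌) unitInterval.mid default) = SSet.vertexPoint X x :=
      cell_degenerate _ _ _
    rw [← h, key, cell_degenerate, cell_degenerate]

/-! ### Simplicial homotopies -/

/-- The triangulation of a prism. -/
lemma exists_prism (p q : SimplexCategory) :
    ∃ G : C(stdSimplex ℝ (Fin (p.len + 1)) × stdSimplex ℝ (Fin (q.len + 1)),
        SSet.toTop.obj (SSet.stdSimplex.{u}.obj p ⊗ SSet.stdSimplex.{u}.obj q)),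
      ∀ {m : SimplexCategory} (f : m ⟶ p) (g : m ⟶ q) (t : stdSimplex ℝ (Fin (m.len + 1))),
        G (stdSimplex.map f t, stdSimplex.map g t) =
          cell (X := _ ⊗ _) (n := m)
            (SSet.stdSimplex.objEquiv.symm f, SSet.stdSimplex.objEquiv.symm g) t := by
  have fin : ∀ n, SSet.Finite (SSet.stdSimplex.{u}.obj n) := by
    intro n
    induction n using SimplexCategory.rec with | _ n
    infer_instance
  have := fin p
  have := fin q
  obtain ⟨G, hG⟩ := exists_inverse
    (X := SSet.stdSimplex.{u}.obj p ⊗ SSet.stdSimplex.{u}.obj q)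
    (Z := stdSimplex ℝ (Fin (p.len + 1)) × stdSimplex ℝ (Fin (q.len + 1)))
    (fun {m} y => ⟨fun t => (stdSimplex.map (SSet.stdSimplex.objEquiv y.1) t,
      stdSimplex.map (SSet.stdSimplex.objEquiv y.2) t),
      (stdSimplex.continuous_map _).prodMk (stdSimplex.continuous_map _)⟩)
    (fun {k m} θ y t => by
      dsimp only [coe_mk]
      rw [map_map, map_map]
      rfl)
    (fun t => by
      obtain ⟨m, f, g, z, -, h, h'⟩ := exists_coupling t.1 t.2
      exact ⟨m, (SSet.stdSimplex.objEquiv.symm f, SSet.stdSimplex.objEquiv.symm g), z,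
        Prod.ext h h'⟩)
    -- Pull both points back to one interior point `z`; each of the two coordinates, being
    -- determined by the image of `z`, then agrees.
    (fun {k m} y y' t t' h => by
      obtain ⟨l, f, g, z, hz, rfl, rfl⟩ := exists_coupling t t'
      rw [← cell_map, ← cell_map]
      refine congrArg (fun w => cell w z) ?_
      refine Prod.ext
        (SSet.stdSimplex.objEquiv.injective (hom_eq_of_map_eq
          (f := f ≫ SSet.stdSimplex.objEquiv y.1) (g := g ≫ SSet.stdSimplex.objEquiv y'.1) hz ?_))
        (SSet.stdSimplex.objEquiv.injective (hom_eq_of_map_eq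
          (f := f ≫ SSet.stdSimplex.objEquiv y.2) (g := g ≫ SSet.stdSimplex.objEquiv y'.2) hz ?_))
      · rw [← map_map, ← map_map]
        exact congrArg Prod.fst h
      · rw [← map_map, ← map_map]
        exact congrArg Prod.snd h)
  exact ⟨G, fun {m} f g t =>
    hG (n := m) (SSet.stdSimplex.objEquiv.symm f, SSet.stdSimplex.objEquiv.symm g) t⟩

/-- The constant simplex of `Δ[1]`. -/
def constSimplex (n : SimplexCategory) (i : Fin 2) : (SSet.stdSimplex.{u}.obj ⦋1⦌).obj (op n) :=
  SSet.stdSimplex.objEquiv.symm (SimplexCategory.const n ⦋1⦌ i)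

/-- The homotopy of maps of realizations given by a simplicial homotopy. -/
lemma exists_homotopy (h : X ⊗ SSet.stdSimplex.obj ⦋1⦌ ⟶ Y) {f g : X ⟶ Y}
    (hf : ∀ {n : SimplexCategory} (x : X.obj (op n)),
      h.app (op n) (x, constSimplex n 0) = f.app (op n) x)
    (hg : ∀ {n : SimplexCategory} (x : X.obj (op n)),
      h.app (op n) (x, constSimplex n 1) = g.app (op n) x) :
    ∃ H : C(SSet.toTop.obj X, C(unitInterval, SSet.toTop.obj Y)),
      (∀ a, H a 0 = SSet.toTop.map f a) ∧ (∀ a, H a 1 = SSet.toTop.map g a) ∧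
      ∀ (x : X.obj (op ⦋0⦌)) (y : Y.obj (op ⦋0⦌)),
        (∀ {n : SimplexCategory} (θ : n ⟶ ⦋0⦌) (r : (SSet.stdSimplex.obj ⦋1⦌).obj (op n)),
          h.app (op n) (X.map θ.op x, r) = Y.map θ.op y) →
        ∀ s, H (SSet.vertexPoint X x) s = SSet.vertexPoint Y y := by
  choose G hG using fun p => exists_prism.{u} p ⦋1⦌
  have key : ∀ {n m : SimplexCategory} (x : X.obj (op n)) (θ : m ⟶ n) (r : m ⟶ ⦋1⦌)
      (t : stdSimplex ℝ (Fin (m.len + 1))),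
      SSet.toTop.map (SSet.yonedaEquiv.symm x ▷ _ ≫ h)
        (G n (stdSimplex.map θ t, stdSimplex.map r t)) =
      cell (h.app (op m) (X.map θ.op x, SSet.stdSimplex.objEquiv.symm r)) t := by
    intro n m x θ r t
    rw [hG]
    exact toTop_map_cell (X := _ ⊗ _) _ _ _
  let F : ∀ {n : SimplexCategory}, X.obj (op n) →
      C(stdSimplex ℝ (Fin (n.len + 1)), C(unitInterval, SSet.toTop.obj Y)) := fun {n} x =>
    ContinuousMap.curry ((SSet.toTop.map (SSet.yonedaEquiv.symm x ▷ _ ≫ h)).hom.comp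
      ((G n).comp ⟨fun q => (q.1, stdSimplexHomeomorphUnitInterval.symm q.2), by fun_prop⟩))
  have hF : ∀ {n : SimplexCategory} (x : X.obj (op n)) t s, F x t s =
    SSet.toTop.map (SSet.yonedaEquiv.symm x ▷ _ ≫ h)
        (G n (t, stdSimplexHomeomorphUnitInterval.symm s)) := fun x t s => rfl
  have hnat : ∀ {m n : SimplexCategory} (θ : m ⟶ n) (x : X.obj (op n)) t,
      F (X.map θ.op x) t = F x (stdSimplex.map θ t) := by
    intro m n θ x t
    ext s
    rw [hF, hF]
    -- The prism map is only specified on pairs of images of one point, so `t` and `s` are first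
    -- coupled.
    obtain ⟨l, f, g, z, hz, rfl, hg⟩ := exists_coupling (q := ⦋1⦌) t
      (stdSimplexHomeomorphUnitInterval.symm s)
    rw [← hg, map_map]
    refine (key _ _ _ _).trans (Eq.trans ?_ (key _ _ _ _).symm)
    rw [op_comp, X.map_comp]
    rfl
  -- An endpoint of the interval is the image of any `t` under a constant map to `[1]`, so the
  -- homotopy there is computed on constant simplices.
  have hend : ∀ (i : Fin 2) (s : unitInterval),
      stdSimplexHomeomorphUnitInterval (stdSimplex.vertex i) = s →
      ∀ {n : SimplexCategory} (x : X.obj (op n)) t,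
        lift F hnat (cell x t) s = cell (h.app (op n) (x, constSimplex n i)) t := by
    intro i s hs n x t
    rw [lift_cell, hF]
    have hc : stdSimplex.map (SimplexCategory.const n ⦋1⦌ i) t =
        stdSimplexHomeomorphUnitInterval.symm s := by
      rw [Homeomorph.eq_symm_apply, ← hs]
      congr 1
      ext j
      rw [stdSimplex.map_apply_eq_sum]
      have hsum := stdSimplex.sum_eq_one t
      by_cases hij : i = j
      · subst hij
        refine (Finset.sum_congr (Finset.filter_true_of_mem fun k _ => rfl)
          fun _ _ => rfl).trans (hsum.trans ?_)
        simp
      · refine (Finset.sum_congr (Finset.filter_false_of_mem fun k _ => hij)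
          fun _ _ => rfl).trans ?_
        simp [Ne.symm hij]
    have hid : stdSimplex.map (𝟙 n : n ⟶ n) t = t := stdSimplex.map_id_apply t
    rw [← hc]
    nth_rw 1 [← hid]
    refine (key x (𝟙 n) _ t).trans ?_
    rw [op_id, X.map_id]
    rfl
  refine ⟨lift F hnat, fun a => ?_, fun a => ?_, fun x y hxy s => ?_⟩
  · obtain ⟨n, x, t, rfl⟩ := exists_cell a
    rw [hend 0 0 stdSimplexHomeomorphUnitInterval_zero, hf, toTop_map_cell]
  · obtain ⟨n, x, t, rfl⟩ := exists_cell a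
    rw [hend 1 1 stdSimplexHomeomorphUnitInterval_one, hg, toTop_map_cell]
  -- Over the vertex `x` all simplices of the prism go to degeneracies of `y`, whose cells are the
  -- single point `y`.
  · rw [vertexPoint_eq_cell x default, lift_cell, hF]
    obtain ⟨l, f, g, z, hz, hz', hg⟩ := exists_coupling (p := ⦋0⦌) (q := ⦋1⦌) default
      (stdSimplexHomeomorphUnitInterval.symm s)
    rw [← hg, ← hz']
    refine (key x f g z).trans ?_
    rw [hxy, cell_degenerate]

end Realization

/-! ### Homotopies given by natural transformations -/

section ArrowEval

variable {D : Type*} [Category* D] {D' : Type*} [Category* D'] {J : Type*} [Category* J]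

/-- The evaluation `Arrow D × [1] ⥤ D`. -/
def arrowEval (D : Type*) [Category* D] : Arrow D × Fin 2 ⥤ D :=
  Functor.uncurry.obj
    { obj := fun f => ComposableArrows.mk₁ f.hom
      map := fun φ => ComposableArrows.homMk₁ φ.left φ.right φ.w.symm
      map_id := fun f => NatTrans.ext (funext fun i => by fin_cases i <;> rfl)
      map_comp := fun φ φ' => NatTrans.ext (funext fun i => by fin_cases i <;> rfl) }

/-- The functor sending an object to its identity. -/
def arrowId (D : Type*) [Category* D] : D ⥤ Arrow D where
  obj X := Arrow.mk (𝟙 X)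
  map f := Arrow.homMk f f

lemma arrowEval_map_left {f g : Arrow D} (φ : f ⟶ g) (u : (0 : Fin 2) ⟶ 0) :
    (arrowEval D).map (X := (f, (0 : Fin 2))) (Y := (g, (0 : Fin 2))) (φ, u) = φ.left :=
  Category.comp_id φ.left

lemma arrowEval_map_right {f g : Arrow D} (φ : f ⟶ g) (u : (1 : Fin 2) ⟶ 1) :
    (arrowEval D).map (X := (f, (1 : Fin 2))) (Y := (g, (1 : Fin 2))) (φ, u) = φ.right :=
  Category.comp_id φ.right

lemma arrowEval_map_left_right {f g : Arrow D} (φ : f ⟶ g) (u : (0 : Fin 2) ⟶ 1) :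
    (arrowEval D).map (X := (f, (0 : Fin 2))) (Y := (g, (1 : Fin 2))) (φ, u) = φ.left ≫ g.hom :=
  rfl

/-- Two functors on `Arrow D × [1]` that agree. -/
lemma arrow_prod_functor_ext {F G : Arrow D × Fin 2 ⥤ D'}
    (h₀ : ∀ f, F.obj (f, 0) = G.obj (f, 0)) (h₁ : ∀ f, F.obj (f, 1) = G.obj (f, 1))
    (m₀ : ∀ {f g : Arrow D} (φ : f ⟶ g),
      HEq (F.map (X := (f, (0 : Fin 2))) (Y := (g, (0 : Fin 2))) (φ, 𝟙 _))
        (G.map (X := (f, (0 : Fin 2))) (Y := (g, (0 : Fin 2))) (φ, 𝟙 _)))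
    (m₁ : ∀ {f g : Arrow D} (φ : f ⟶ g),
      HEq (F.map (X := (f, (1 : Fin 2))) (Y := (g, (1 : Fin 2))) (φ, 𝟙 _))
        (G.map (X := (f, (1 : Fin 2))) (Y := (g, (1 : Fin 2))) (φ, 𝟙 _)))
    (m : ∀ {f g : Arrow D} (φ : f ⟶ g),
      HEq (F.map (X := (f, (0 : Fin 2))) (Y := (g, (1 : Fin 2))) (φ, homOfLE (Fin.zero_le 1)))
        (G.map (X := (f, (0 : Fin 2))) (Y := (g, (1 : Fin 2))) (φ, homOfLE (Fin.zero_le 1)))) :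
    F = G := by
  refine Functor.hext ?_ ?_
  · rintro ⟨f, i⟩
    fin_cases i
    · exact h₀ f
    · exact h₁ f
  · rintro ⟨f, i⟩ ⟨g, j⟩ ⟨φ, u⟩
    have hij : i ≤ j := leOfHom u
    fin_cases i <;> fin_cases j
    · exact m₀ φ
    · exact m φ
    · exact absurd hij (by decide)
    · exact m₁ φ

lemma arrowEval_naturality (G : D ⥤ D') :
    arrowEval D ⋙ G = G.mapArrow.prod (𝟭 (Fin 2)) ⋙ arrowEval D' := by
  refine arrow_prod_functor_ext (fun f => rfl) (fun f => rfl) (fun φ => heq_of_eq ?_)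
    (fun φ => heq_of_eq ?_) (fun φ => heq_of_eq ?_)
  · exact (congrArg G.map (arrowEval_map_left φ _)).trans
      (arrowEval_map_left (G.mapArrow.map φ) _).symm
  · exact (congrArg G.map (arrowEval_map_right φ _)).trans
      (arrowEval_map_right (G.mapArrow.map φ) _).symm
  · exact (congrArg G.map (arrowEval_map_left_right φ (homOfLE (Fin.zero_le 1)))).trans
      (G.map_comp _ _)

/-- Evaluating an identity arrow does not see the coordinate in `[1]`. This keeps the homotopies
constant at the base point. -/
lemma prod'_comp_arrowEval_of_id (K : J ⥤ D) (r : J ⥤ Fin 2) :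
    (K ⋙ arrowId D).prod' r ⋙ arrowEval D = K := by
  have hobj : ∀ (x : D) (i : Fin 2), (arrowEval D).obj (Arrow.mk (𝟙 x), i) = x := by
    intro x i
    fin_cases i <;> rfl
  have hmap : ∀ {x y : D} (f : x ⟶ y) {i j : Fin 2} (u : i ⟶ j),
      HEq ((arrowEval D).map (X := (Arrow.mk (𝟙 x), i)) (Y := (Arrow.mk (𝟙 y), j))
        ((arrowId D).map f, u)) f := by
    intro x y f i j u
    have hij := leOfHom u
    fin_cases i <;> fin_cases j
    · exact heq_of_eq (arrowEval_map_left _ _)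
    · exact heq_of_eq ((arrowEval_map_left_right ((arrowId D).map f) u).trans
        (Category.comp_id f))
    · exact absurd hij (by decide)
    · exact heq_of_eq (arrowEval_map_right _ _)
  exact Functor.hext (fun j => hobj _ _) (fun i j f => hmap _ _)

/-- This and `prod'_comp_arrowEval_one` identify the two ends of the evaluation homotopy as the
source and the target. -/
lemma prod'_comp_arrowEval_zero (E : J ⥤ Arrow D) (r : J ⥤ Fin 2) (hr : ∀ j, r.obj j = 0) :
    E.prod' r ⋙ arrowEval D = E ⋙ Arrow.leftFunc := by
  obtain rfl : r = (Functor.const J).obj 0 :=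
    Functor.hext hr fun _ _ _ => Subsingleton.helim (by rw [hr, hr]; rfl) _ _
  exact Functor.hext (fun j => rfl) fun i j f => heq_of_eq (arrowEval_map_left _ _)

lemma prod'_comp_arrowEval_one (E : J ⥤ Arrow D) (r : J ⥤ Fin 2) (hr : ∀ j, r.obj j = 1) :
    E.prod' r ⋙ arrowEval D = E ⋙ Arrow.rightFunc := by
  obtain rfl : r = (Functor.const J).obj 1 :=
    Functor.hext hr fun _ _ _ => Subsingleton.helim (by rw [hr, hr]; rfl) _ _
  exact Functor.hext (fun j => rfl) fun i j f => heq_of_eq (arrowEval_map_right _ _)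

lemma arrowId_mapArrow (G : D ⥤ D') : arrowId D ⋙ G.mapArrow = G ⋙ arrowId D' := by
  have h : ∀ x : D, Arrow.mk (G.map (𝟙 x)) = Arrow.mk (𝟙 (G.obj x)) := fun x => by
    rw [G.map_id]
  have hmap : ∀ {x y : D'} {i i' : x ⟶ x} {j j' : y ⟶ y} (_ : i = i') (_ : j = j') (f : x ⟶ y)
      (w : f ≫ j = i ≫ f) (w' : f ≫ j' = i' ≫ f),
      HEq (Arrow.homMk f f w : Arrow.mk i ⟶ Arrow.mk j)
        (Arrow.homMk f f w' : Arrow.mk i' ⟶ Arrow.mk j') := by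
    rintro x y i _ j _ rfl rfl f w w'
    rfl
  exact Functor.hext h fun x y f => hmap (G.map_id x) (G.map_id y) (G.map f) _ _

end ArrowEval

namespace SimplicialCat

open MonoidalCategory

/-- The map of diagonals induced by a map of simplicial categories. -/
def diagNerveMap {X X' : SimplexCategoryᵒᵖ ⥤ Cat.{v, u}} (α : X ⟶ X') :
    diagNerve X ⟶ diagNerve X' where
  app n := (nerveMap (α.app n).toFunctor).app n
  naturality m n θ := by
    ext F
    exact congrArg (fun G : X.obj m ⥤ X'.obj n => (SimplexCategory.toCat.map θ.unop).toFunctor ⋙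
      (show Fin (m.unop.len + 1) ⥤ X.obj m from F) ⋙ G)
      (congrArg Cat.Hom.toFunctor (α.naturality θ))

variable (X : SimplexCategoryᵒᵖ ⥤ Cat.{v, max u v})

/-- The simplicial category of arrows of a simplicial category. -/
def arrows : SimplexCategoryᵒᵖ ⥤ Cat.{v, max u v} where
  obj n := Cat.of (Arrow (X.obj n))
  map θ := (X.map θ).toFunctor.mapArrow.toCatHom
  map_id n := by rw [X.map_id]; rfl
  map_comp θ θ' := by rw [X.map_comp]; rfl

/-- The source of an arrow. -/
def arrowsSource : arrows.{v, u} X ⟶ X where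
  app _ := Arrow.leftFunc.toCatHom
  naturality _ _ _ := rfl

/-- The target of an arrow. -/
def arrowsTarget : arrows.{v, u} X ⟶ X where
  app _ := Arrow.rightFunc.toCatHom
  naturality _ _ _ := rfl

/-- The identity arrows. -/
def arrowsId : X ⟶ arrows.{v, u} X where
  app n := (arrowId (X.obj n)).toCatHom
  naturality _ _ θ := congrArg Functor.toCatHom (arrowId_mapArrow (X.map θ).toFunctor).symm

/-- A simplex of `Δ[1]` as a functor. -/
def simplexFunctor {n : SimplexCategoryᵒᵖ} (r : (SSet.stdSimplex.{u}.obj ⦋1⦌).obj n) :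
    Fin (n.unop.len + 1) ⥤ Fin 2 :=
  (SSet.stdSimplex.objEquiv r).toOrderHom.monotone.functor

/-- The evaluation homotopy. -/
def arrowsEval : diagNerve (arrows.{v, u} X) ⊗ SSet.stdSimplex.obj ⦋1⦌ ⟶ diagNerve X where
  app n := TypeCat.ofHom fun q =>
    -- A chain of arrows and a map `[n] ⟶ [1]` give the chain that follows the sources before the
    -- jump and the targets after it.
    (Functor.prod' (show Fin (n.unop.len + 1) ⥤ Arrow (X.obj n) from q.1)
      (simplexFunctor q.2) ⋙ arrowEval (X.obj n) : Fin (n.unop.len + 1) ⥤ X.obj n)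
  naturality m n θ := by
    ext ⟨F, r⟩
    exact congrArg (fun G : Arrow (X.obj m) × Fin 2 ⥤ X.obj n =>
      (SimplexCategory.toCat.map θ.unop).toFunctor ⋙
        Functor.prod' (show Fin (m.unop.len + 1) ⥤ Arrow (X.obj m) from F) (simplexFunctor r) ⋙ G)
      (arrowEval_naturality (X.map θ).toFunctor).symm

variable {X}

/-- A family of natural transformations gives a homotopy. -/
lemma exists_homotopy_of_arrows {Z : SSet.{max u v}} (E : Z ⟶ diagNerve (arrows.{v, u} X)) :
    ∃ H : C(SSet.toTop.obj Z, C(unitInterval, realization X)),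
      (∀ a, H a 0 = SSet.toTop.map (E ≫ diagNerveMap (arrowsSource X)) a) ∧
      (∀ a, H a 1 = SSet.toTop.map (E ≫ diagNerveMap (arrowsTarget X)) a) ∧
      ∀ (x : Z.obj (op ⦋0⦌)) (y : (diagNerve X).obj (op ⦋0⦌)),
        E.app _ x = (diagNerveMap (arrowsId X)).app _ y →
        ∀ s, H (SSet.vertexPoint Z x) s = SSet.vertexPoint _ y := by
  obtain ⟨H, h₀, h₁, h⟩ := Realization.exists_homotopy (E ▷ _ ≫ arrowsEval X)
    (f := E ≫ diagNerveMap (arrowsSource X)) (g := E ≫ diagNerveMap (arrowsTarget X))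
    (fun {n} x => prod'_comp_arrowEval_zero _ _ fun _ => rfl)
    (fun {n} x => prod'_comp_arrowEval_one _ _ fun _ => rfl)
  refine ⟨H, h₀, h₁, fun x y hxy => h x y fun {n} θ r => ?_⟩
  -- The vertex `x` gives an identity arrow, and this persists for all its degeneracies.
  have e : E.app (op n) (Z.map θ.op x) =
      (diagNerveMap (arrowsId X)).app (op n) ((diagNerve X).map θ.op y) := by
    have e₁ := ConcreteCategory.congr_hom (E.naturality θ.op) x
    have e₂ := ConcreteCategory.congr_hom ((diagNerveMap (arrowsId X)).naturality θ.op) y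
    exact e₁.trans ((congrArg ((diagNerve (arrows.{v, u} X)).map θ.op) hxy).trans e₂.symm)
  refine Eq.trans (congrArg (fun w => (arrowsEval X).app (op n) (w, r)) e) ?_
  exact prod'_comp_arrowEval_of_id _ _

end SimplicialCat

/-! ### Based homotopies and loop spaces -/

section Loops

variable {A B : Type*} [TopologicalSpace A] [TopologicalSpace B] {a : A} {b : B}

/-- The map of loop spaces induced by a based map. -/
def loopMap (f : C(A, B)) (hf : f a = b) : C(LoopSpace A a, LoopSpace B b) where
  toFun γ := ⟨f.comp γ.toContinuousMap, by simp [hf], by simp [hf]⟩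
  continuous_toFun := by
    refine continuous_induced_rng.2 ?_
    exact (continuous_postcomp f).comp continuous_induced_dom

/-- Apply the homotopy pointwise along a loop; since it fixes the base point, each stage is again a
loop. -/
lemma loopMap_homotopic {f g : C(A, B)} (hf : f a = b) (hg : g a = b)
    (H : C(A, C(unitInterval, B))) (h₀ : ∀ x, H x 0 = f x) (h₁ : ∀ x, H x 1 = g x)
    (h : ∀ s, H a s = b) : (loopMap f hf).Homotopic (loopMap g hg) := by
  refine ⟨⟨⟨fun q => ⟨⟨fun t => H (q.2 t) q.1, by fun_prop⟩, by simp [h], by simp [h]⟩, ?_⟩,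
    fun γ => ?_, fun γ => ?_⟩⟩
  · refine continuous_induced_rng.2 ?_
    refine ContinuousMap.continuous_of_continuous_uncurry _ ?_
    change Continuous fun q : (unitInterval × LoopSpace A a) × unitInterval => H (q.1.2 q.2) q.1.1
    fun_prop
  · ext t
    exact h₀ _
  · ext t
    exact h₁ _

end Loops

/-! ### Quotients in Waldhausen categories -/

namespace WaldhausenCategory

variable {C : Type u} [Category.{v} C] (W : WaldhausenCategory C)

/-- `q` is a quotient map of `f`. -/
def IsQuotient {A B Q : C} (f : A ⟶ B) (q : B ⟶ Q) : Prop :=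
  IsPushout f (W.isZero_zero.from_ A) q (W.isZero_zero.to_ Q)

section IsQuotient

variable {W} {A B Q A' B' Q' : C} {f : A ⟶ B} {q : B ⟶ Q} {f' : A' ⟶ B'} {q' : B' ⟶ Q'}

lemma IsQuotient.of_isPushout {Z : C} (hZ : Limits.IsZero Z) {g : A ⟶ Z} {i : Z ⟶ Q}
    (h : IsPushout f g q i) : W.IsQuotient f q :=
  IsPushout.of_iso h (Iso.refl _) (Iso.refl _) (hZ.iso W.isZero_zero) (Iso.refl _)
    (by simp) (W.isZero_zero.eq_of_tgt _ _) (by simp) (hZ.eq_of_src _ _)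

lemma IsQuotient.w (h : W.IsQuotient f q) :
    f ≫ q = W.isZero_zero.from_ A ≫ W.isZero_zero.to_ Q :=
  CommSq.w h.toCommSq

lemma IsQuotient.hom_ext (h : W.IsQuotient f q) {X : C} {s t : Q ⟶ X} (e : q ≫ s = q ≫ t) :
    s = t :=
  IsPushout.hom_ext h e (W.isZero_zero.eq_of_src _ _)

/-- The map of quotients induced by a commutative square. -/
noncomputable def IsQuotient.map (h : W.IsQuotient f q) (h' : W.IsQuotient f' q') (a : A ⟶ A')
    (b : B ⟶ B') (w : f ≫ b = a ≫ f') : Q ⟶ Q' :=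
  IsPushout.desc h (b ≫ q') (W.isZero_zero.to_ Q') (by
    rw [← Category.assoc, w, Category.assoc, h'.w, ← Category.assoc]
    congr 1
    exact W.isZero_zero.eq_of_tgt _ _)

lemma IsQuotient.comp_map (h : W.IsQuotient f q) (h' : W.IsQuotient f' q') (a : A ⟶ A')
    (b : B ⟶ B') (w : f ≫ b = a ≫ f') : q ≫ h.map h' a b w = b ≫ q' :=
  IsPushout.inl_desc _ _ _ _

/-- The map of quotients induced by a distinguished square is a weak equivalence. -/
lemma IsQuotient.weq_map (h : W.IsQuotient f q) (h' : W.IsQuotient f' q') (hf : W.cof f)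
    (hf' : W.cof f') {a : A ⟶ A'} {b : B ⟶ B'} (H : W.IsDist f f' a b) {p : Q ⟶ Q'}
    (hp : q ≫ p = b ≫ q') : W.weq p := by
  -- Factor the square through the pushout `P = B ∪_A A'`. Cancelling pushouts, `P/A'` is again `Q`,
  -- so `p` is the map of quotients by `A'` induced by the weak equivalence `t : P ⟶ B'`, and gluing
  -- applies.
  obtain ⟨P, inl, inr, hP, t, rfl, rfl, ht⟩ := H.exists_of hf
  have hw : f ≫ q = a ≫ W.isZero_zero.from_ A' ≫ W.isZero_zero.to_ Q := by
    rw [h.w, ← Category.assoc]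
    congr 1
    exact W.isZero_zero.eq_of_tgt _ _
  have hQ : IsPushout inr (W.isZero_zero.from_ A')
      (hP.desc q (W.isZero_zero.from_ A' ≫ W.isZero_zero.to_ Q) hw) (W.isZero_zero.to_ Q) := by
    refine IsPushout.flip (IsPushout.of_left (h₁₁ := a) (v₁₁ := f) (v₁₂ := inr) (h₂₁ := inl)
      ?_ ?_ hP.flip)
    · have e : a ≫ W.isZero_zero.from_ A' = W.isZero_zero.from_ A :=
        W.isZero_zero.eq_of_tgt _ _
      rw [e, IsPushout.inl_desc]
      exact IsPushout.flip h
    · simp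
  refine W.gluing hQ h' (W.cof_pushout hP hf) hf' (a := 𝟙 _) (b := t) (d := 𝟙 _) (by simp)
    (by simp) ?_ (W.isZero_zero.eq_of_src _ _) (W.weq_of_isIso _) ht (W.weq_of_isIso _)
  apply hP.hom_ext
  · rw [← Category.assoc, IsPushout.inl_desc, hp, Category.assoc]
  · rw [← Category.assoc, IsPushout.inr_desc, ← Category.assoc, h'.w, Category.assoc]
    congr 1
    exact W.isZero_zero.eq_of_src _ _

lemma IsQuotient.isIso_of_comp_eq {r : B ⟶ Q'} (h : W.IsQuotient f q) (h' : W.IsQuotient f r)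
    {p : Q ⟶ Q'} (hp : q ≫ p = r) : IsIso p := by
  have : p = (IsPushout.isoIsPushout _ _ h h').hom := h.hom_ext
    (hp.trans (IsPushout.inl_isoIsPushout_hom _ _ h h').symm)
  rw [this]
  infer_instance

/-- Successive quotients. -/
lemma IsQuotient.isPushout_comp {D R : C} {g : B ⟶ D} {r : D ⟶ R} (h : W.IsQuotient f q)
    (h' : W.IsQuotient (f ≫ g) r) {p : Q ⟶ R} (hp : q ≫ p = g ≫ r) : IsPushout g q r p := by
  refine IsPushout.of_left (h₁₁ := f) (v₁₁ := W.isZero_zero.from_ A)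
    (h₂₁ := W.isZero_zero.to_ Q) ?_ hp.symm h
  have e : W.isZero_zero.to_ Q ≫ p = W.isZero_zero.to_ R := W.isZero_zero.eq_of_src _ _
  rw [e]
  exact h'

end IsQuotient

/-! ### Chosen quotients -/

section Chosen

variable {W} {A B : C} (f : A ⟶ B)

/-- For an isomorphism the zero object itself must be chosen: the `S`-construction requires
`A_{j,j}` to equal it, not merely to be isomorphic to it. -/
lemma exists_isQuotient (hf : W.cof f) :
    ∃ (Q : C) (q : B ⟶ Q), W.IsQuotient f q ∧ (IsIso f → Q = W.zero) := by
  by_cases h : IsIso f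
  · have : IsIso (W.isZero_zero.to_ W.zero) :=
      ⟨W.isZero_zero.from_ W.zero, W.isZero_zero.eq_of_src _ _, W.isZero_zero.eq_of_src _ _⟩
    exact ⟨W.zero, W.isZero_zero.from_ B, IsPushout.of_horiz_isIso
      ⟨W.isZero_zero.eq_of_tgt _ _⟩, fun _ => rfl⟩
  · have := W.hasPushout f (W.isZero_zero.from_ A) hf
    refine ⟨_, _, IsQuotient.of_isPushout W.isZero_zero
      (IsPushout.of_hasPushout f (W.isZero_zero.from_ A)), fun h' => absurd h' h⟩

variable (W) in
/-- A chosen quotient of a cofibration, equal to the zero object for isomorphisms. -/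
noncomputable def quot (hf : W.cof f) : C := (exists_isQuotient f hf).choose

variable (W) in
/-- The map to the chosen quotient. -/
noncomputable def toQuot (hf : W.cof f) : B ⟶ W.quot f hf :=
  (exists_isQuotient f hf).choose_spec.choose

lemma isQuotient_toQuot (hf : W.cof f) : W.IsQuotient f (W.toQuot f hf) :=
  (exists_isQuotient f hf).choose_spec.choose_spec.1

lemma quot_eq_zero (hf : W.cof f) [IsIso f] : W.quot f hf = W.zero :=
  (exists_isQuotient f hf).choose_spec.choose_spec.2 inferInstance

end Chosen

/-- Squares of weak equivalences are distinguished. -/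
lemma isDist_of_weq {A B A' B' : C} {f : A ⟶ B} {f' : A' ⟶ B'} {a : A ⟶ A'} {b : B ⟶ B'}
    (hf : W.cof f) (hf' : W.cof f') (w : f ≫ b = a ≫ f') (ha : W.weq a) (hb : W.weq b) :
    W.IsDist f f' a b := by
  have := W.hasPushout f a hf
  have hP := IsPushout.of_hasPushout f a
  have hB : IsPushout f' (𝟙 A') (𝟙 B') f' := IsPushout.of_vert_isIso ⟨by simp⟩
  refine IsDist.mk_of hP (hP.desc b f' w) (by simp) (by simp) ?_
  -- `B'` is the pushout of `f'` along the identity, so the comparison map is glued from `a`, `b`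
  -- and an identity.
  exact W.gluing hP hB hf hf' (a := a) (b := b) (d := 𝟙 A') w (by simp) (by simp) (by simp)
    ha hb (W.weq_of_isIso _)

lemma isDist_of_isPushout {A B A' B' : C} {f : A ⟶ B} {f' : A' ⟶ B'} {a : A ⟶ A'} {b : B ⟶ B'}
    (h : IsPushout f a b f') : W.IsDist f f' a b :=
  IsDist.mk_of h (𝟙 _) (by simp) (by simp) (W.weq_of_isIso _)

/-! ### Accessors for the squares category of a Waldhausen category -/

variable {W}

section HFun

variable {J : Type} [Category.{0} J]

/-- The objects of a horizontal functor. -/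
def ob (F : W.squaresCategory.HFun J) (j : J) : C := F.functor.obj j

/-- The cofibrations of a horizontal functor. -/
def mor (F : W.squaresCategory.HFun J) {i j : J} (f : i ⟶ j) : ob F i ⟶ ob F j :=
  (F.functor.map f).1

lemma cof_mor (F : W.squaresCategory.HFun J) {i j : J} (f : i ⟶ j) : W.cof (mor F f) :=
  (F.functor.map f).2

lemma mor_id (F : W.squaresCategory.HFun J) (i : J) : mor F (𝟙 i) = 𝟙 (ob F i) :=
  congrArg Subtype.val (F.functor.map_id i)

lemma mor_comp (F : W.squaresCategory.HFun J) {i j k : J} (f : i ⟶ j) (g : j ⟶ k) :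
    mor F (f ≫ g) = mor F f ≫ mor F g :=
  congrArg Subtype.val (F.functor.map_comp f g)

/-- The components of a morphism of horizontal functors. -/
def comp {F G : W.squaresCategory.HFun J} (α : F ⟶ G) (j : J) : ob F j ⟶ ob G j :=
  SquaresCategory.HFun.Hom.app α j

lemma isDist_comp {F G : W.squaresCategory.HFun J} (α : F ⟶ G) {i j : J} (f : i ⟶ j) :
    W.IsDist (mor F f) (mor G f) (comp α i) (comp α j) :=
  SquaresCategory.HFun.Hom.dist α f

lemma mor_comp_comp {F G : W.squaresCategory.HFun J} (α : F ⟶ G) {i j : J} (f : i ⟶ j) :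
    mor F f ≫ comp α j = comp α i ≫ mor G f :=
  (isDist_comp α f).1

/-- A functor all of whose morphisms are cofibrations, as a horizontal functor. -/
def hFunOfFunctor (F : J ⥤ C) (h : ∀ {i j : J} (f : i ⟶ j), W.cof (F.map f)) :
    W.squaresCategory.HFun J where
  functor :=
    { obj := fun j => F.obj j
      map := fun f => ⟨F.map f, h f⟩
      map_id := fun i => Subtype.ext (F.map_id i)
      map_comp := fun f g => Subtype.ext (F.map_comp f g) }

/-- A constructor for morphisms of horizontal functors. -/
def hFunHom {F G : W.squaresCategory.HFun J} (app : ∀ j, ob F j ⟶ ob G j)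
    (dist : ∀ {i j : J} (f : i ⟶ j), W.IsDist (mor F f) (mor G f) (app i) (app j)) : F ⟶ G :=
  SquaresCategory.HFun.Hom.mk app dist

lemma hFun_hom_ext {F G : W.squaresCategory.HFun J} {α β : F ⟶ G}
    (h : ∀ j, comp α j = comp β j) : α = β :=
  SquaresCategory.HFun.Hom.ext (funext h)

end HFun

/-! ### From horizontal functors to the `S`-construction -/

section Psi

variable {n : ℕ}

/-- The commutative square of a horizontal functor given by a morphism of arrows. -/
lemma mor_hom_comp (F : W.squaresCategory.HFun (Fin (n + 1))) {x y : Arrow (Fin (n + 1))}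
    (φ : x ⟶ y) : mor F x.hom ≫ mor F φ.right = mor F φ.left ≫ mor F y.hom := by
  rw [← mor_comp, ← mor_comp]
  congr 1

/-- The diagram of quotients of a horizontal functor. -/
noncomputable def quotFunctor (F : W.squaresCategory.HFun (Fin (n + 1))) :
    Arrow (Fin (n + 1)) ⥤ C where
  obj x := W.quot (mor F x.hom) (cof_mor F _)
  map φ := (isQuotient_toQuot _ _).map (isQuotient_toQuot _ _) (mor F φ.left) (mor F φ.right)
    (mor_hom_comp F φ)
  map_id x := (isQuotient_toQuot _ _).hom_ext (by
    rw [IsQuotient.comp_map, Arrow.id_right, mor_id, Category.id_comp, Category.comp_id])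
  map_comp φ φ' := (isQuotient_toQuot _ _).hom_ext (by
    rw [IsQuotient.comp_map, ← Category.assoc, IsQuotient.comp_map, Category.assoc,
      IsQuotient.comp_map, ← Category.assoc, Arrow.comp_right, mor_comp])

/-- The quotient maps of a horizontal functor. -/
noncomputable def quotProj (F : W.squaresCategory.HFun (Fin (n + 1))) (x : Arrow (Fin (n + 1))) :
    ob F x.right ⟶ (quotFunctor F).obj x :=
  W.toQuot (mor F x.hom) (cof_mor F _)

lemma isQuotient_quotProj (F : W.squaresCategory.HFun (Fin (n + 1))) (x : Arrow (Fin (n + 1))) :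
    W.IsQuotient (mor F x.hom) (quotProj F x) :=
  isQuotient_toQuot _ _

lemma quotProj_map (F : W.squaresCategory.HFun (Fin (n + 1))) {x y : Arrow (Fin (n + 1))}
    (φ : x ⟶ y) :
    quotProj F x ≫ (quotFunctor F).map φ = mor F φ.right ≫ quotProj F y :=
  (isQuotient_quotProj F x).comp_map (isQuotient_quotProj F y) (mor F φ.left) (mor F φ.right)
    (mor_hom_comp F φ)

lemma quotFunctor_obj_id (F : W.squaresCategory.HFun (Fin (n + 1))) (j : Fin (n + 1)) :
    (quotFunctor F).obj (Arrow.mk (𝟙 j)) = W.zero := by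
  have : IsIso (mor F (𝟙 j)) := by rw [mor_id]; infer_instance
  exact quot_eq_zero (mor F (𝟙 j)) (cof_mor F (𝟙 j))

/-- `F(k)/F(i)` is the pushout of `F(k)` and `F(j)/F(i)` over `F(j)`, by cancelling pushouts. It
yields the cofibrations and pushout squares of `quotSObj`, and makes the projections of a chain to
its quotients distinguished. -/
lemma quotFunctor_isPushout_proj (F : W.squaresCategory.HFun (Fin (n + 1)))
    {i j k : Fin (n + 1)} (f : i ⟶ j) (g : j ⟶ k) :
    IsPushout (mor F g) (quotProj F (Arrow.mk f)) (quotProj F (Arrow.mk (f ≫ g)))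
      ((quotFunctor F).map (Arrow.homMk (𝟙 i) g : Arrow.mk f ⟶ Arrow.mk (f ≫ g))) := by
  refine (isQuotient_quotProj F (Arrow.mk f)).isPushout_comp ?_ (quotProj_map F _)
  rw [← mor_comp]
  exact isQuotient_quotProj F (Arrow.mk (f ≫ g))

/-- The object of the `S`-construction given by the quotients of a horizontal functor. -/
noncomputable def quotSObj (F : W.squaresCategory.HFun (Fin (n + 1))) : W.SObj n where
  functor := quotFunctor F
  obj_diag := quotFunctor_obj_id F
  cof_map f g := W.cof_pushout (quotFunctor_isPushout_proj F f g) (cof_mor F g)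
  isPushout {i j k} f g := by
    -- Stack the wanted square under the pushout of projections from `F(j) → F(k)`. The outer
    -- rectangle is the same pushout with `i` replaced by `j`, so the lower square is a pushout too.
    refine IsPushout.of_top (h₁₁ := mor F g) (v₁₁ := quotProj F (Arrow.mk f))
      (v₁₂ := quotProj F (Arrow.mk (f ≫ g))) ?_ ?_ (quotFunctor_isPushout_proj F f g)
    · rw [quotProj_map, quotProj_map]
      have h := quotFunctor_isPushout_proj F (𝟙 j) g
      have e : ∀ k : Fin (n + 1), mor F (𝟙 k) = 𝟙 (ob F k) := mor_id F
      have e₁ : mor F (Arrow.Hom.right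
          (Arrow.homMk f (𝟙 j) : Arrow.mk f ⟶ Arrow.mk (𝟙 j))) = 𝟙 _ := e j
      have e₂ : mor F (Arrow.Hom.right
          (Arrow.homMk f (𝟙 k) : Arrow.mk (f ≫ g) ⟶ Arrow.mk g)) = 𝟙 _ := e k
      rw [e₁, e₂, Category.id_comp, Category.id_comp]
      exact h
    · rw [← Functor.map_comp, ← Functor.map_comp]
      congr 1

/-- The map of quotients induced by a morphism of horizontal functors. -/
noncomputable def quotApp {F G : W.squaresCategory.HFun (Fin (n + 1))} (α : F ⟶ G)
    (x : Arrow (Fin (n + 1))) : (quotFunctor F).obj x ⟶ (quotFunctor G).obj x :=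
  (isQuotient_quotProj F x).map (isQuotient_quotProj G x)
    (comp α x.left) (comp α x.right) (mor_comp_comp α x.hom)

lemma quotProj_app {F G : W.squaresCategory.HFun (Fin (n + 1))} (α : F ⟶ G)
    (x : Arrow (Fin (n + 1))) : quotProj F x ≫ quotApp α x = comp α x.right ≫ quotProj G x :=
  (isQuotient_quotProj F x).comp_map _ _ _ _

/-- The natural transformation of diagrams of quotients. -/
noncomputable def quotNatTrans {F G : W.squaresCategory.HFun (Fin (n + 1))} (α : F ⟶ G) :
    quotFunctor F ⟶ quotFunctor G where
  app := quotApp α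
  naturality x y φ := (isQuotient_quotProj F x).hom_ext (by
    rw [← Category.assoc, quotProj_map, Category.assoc, quotProj_app,
      ← Category.assoc (quotProj F x), quotProj_app, Category.assoc, quotProj_map,
      ← Category.assoc, ← Category.assoc, mor_comp_comp])

lemma quotApp_id (F : W.squaresCategory.HFun (Fin (n + 1))) (x : Arrow (Fin (n + 1))) :
    quotApp (𝟙 F) x = 𝟙 _ :=
  (isQuotient_quotProj F x).hom_ext ((quotProj_app _ x).trans
    ((Category.id_comp (quotProj F x)).trans (Category.comp_id _).symm))

lemma quotApp_comp {F G H : W.squaresCategory.HFun (Fin (n + 1))} (α : F ⟶ G) (β : G ⟶ H)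
    (x : Arrow (Fin (n + 1))) : quotApp (α ≫ β) x = quotApp α x ≫ quotApp β x := by
  have e : comp (α ≫ β) x.right = comp α x.right ≫ comp β x.right := rfl
  refine (isQuotient_quotProj F x).hom_ext ?_
  rw [quotProj_app, e, ← Category.assoc (quotProj F x), quotProj_app, Category.assoc,
    Category.assoc, quotProj_app]

/-- The functor from horizontal functors to the `S`-construction. -/
noncomputable def quotSFunctor (n : ℕ) :
    W.squaresCategory.HFun (Fin (n + 1)) ⥤ W.SObj n where
  obj F := quotSObj F
  map {F G} α := SObj.Hom.mk (quotNatTrans α) fun x =>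
    (isQuotient_quotProj F x).weq_map (isQuotient_quotProj G x)
      (cof_mor F _) (cof_mor G _) (isDist_comp α x.hom) (quotProj_app α x)
  map_id F := SObj.Hom.ext (NatTrans.ext (funext (quotApp_id F)))
  map_comp α β := SObj.Hom.ext (NatTrans.ext (funext (quotApp_comp α β)))

variable (W) in
/-- The map of simplicial categories given by quotients. -/
noncomputable def quotT : W.squaresCategory.T ⟶ W.wS where
  app n := (quotSFunctor n.unop.len).toCatHom
  -- The chosen quotient depends only on the cofibration, so restricting a chain and taking
  -- quotients commute on the nose.
  naturality _ _ _ := rfl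

end Psi

end WaldhausenCategory

/-! ### Maps out of the edgewise subdivision -/

namespace Realization

/-- A map out of the edgewise subdivision, given by a construction that depends on two maps
`l`, `r` with `l ≤ r`. -/
def sdDesc {X Y : SSet.{u}}
    (Φ : ∀ {n N : SimplexCategory} (_ : X.obj (op N)) (l r : n ⟶ N),
      (∀ a b, l a ≤ r b) → Y.obj (op n))
    (h₁ : ∀ {n N M : SimplexCategory} (x : X.obj (op M)) (τ : N ⟶ M) (l r : n ⟶ N)
      (h : ∀ a b, l a ≤ r b),
      Φ (X.map τ.op x) l r h =
        Φ x (l ≫ τ) (r ≫ τ) fun a b => τ.toOrderHom.monotone (h a b))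
    (h₂ : ∀ {m n N : SimplexCategory} (x : X.obj (op N)) (θ : m ⟶ n) (l r : n ⟶ N)
      (h : ∀ a b, l a ≤ r b),
      Y.map θ.op (Φ x l r h) = Φ x (θ ≫ l) (θ ≫ r) fun a b => h (θ a) (θ b)) :
    sd X ⟶ Y where
  app n := TypeCat.ofHom fun x =>
    Φ (n := n.unop) (N := n.unop.double) x n.unop.inl n.unop.inr SimplexCategory.inl_le_inr
  naturality m n θ := by
    ext x
    have congr : ∀ {l l' r r' : n.unop ⟶ m.unop.double} (hl : l = l') (hr : r = r')
        (h : ∀ a b, l a ≤ r b) (h' : ∀ a b, l' a ≤ r' b), Φ x l r h = Φ x l' r' h' := by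
      rintro l _ r _ rfl rfl h h'
      rfl
    -- Both sides are the construction on `x` for the two inclusions precomposed with `θ`.
    refine (h₁ x (SimplexCategory.doubleMap θ.unop) _ _ _).trans ?_
    refine Eq.trans ?_ (h₂ x θ.unop _ _ _).symm
    exact congr (SimplexCategory.inl_doubleMap _) (SimplexCategory.inr_doubleMap _) _ _

end Realization

/-- The functor to arrows given by a natural transformation. -/
def NatTrans.toArrowFunctor {J : Type*} [Category* J] {D : Type*} [Category* D] {F G : J ⥤ D}
    (η : F ⟶ G) : J ⥤ Arrow D where
  obj j := Arrow.mk (η.app j)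
  map f := Arrow.homMk (F.map f) (G.map f) (η.naturality f)

namespace WaldhausenCategory

variable {C : Type u} [Category.{v} C] {W : WaldhausenCategory C}

/-! ### Quotients and pushouts inside a diagram of the `S`-construction -/

section Ar

variable {n : ℕ}

/-- The arrow `i ≤ j`. -/
def ar {i j : Fin (n + 1)} (h : i ≤ j) : Arrow (Fin (n + 1)) := Arrow.mk (homOfLE h)

/-- The morphism of arrows given by inequalities. -/
def arHom {i j i' j' : Fin (n + 1)} {h : i ≤ j} {h' : i' ≤ j'} (hi : i ≤ i') (hj : j ≤ j') :
    ar h ⟶ ar h' :=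
  Arrow.homMk (homOfLE hi) (homOfLE hj)

instance (x y : Arrow (Fin (n + 1))) : Subsingleton (x ⟶ y) :=
  ⟨fun f g => Arrow.hom_ext f g (Subsingleton.elim _ _) (Subsingleton.elim _ _)⟩

variable (A : W.SObj n)

lemma cof_map_arHom {i j k : Fin (n + 1)} (h : i ≤ j) (h' : i ≤ k) (hjk : j ≤ k) :
    W.cof (A.functor.map (arHom le_rfl hjk : ar h ⟶ ar h')) :=
  A.cof_map (homOfLE h) (homOfLE hjk)

/-- This is the pushout axiom of the `S`-construction, read as `A_{j,k} = A_{i,k}/A_{i,j}`. -/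
lemma isQuotient_map_arHom {i j k : Fin (n + 1)} (h : i ≤ j) (h' : i ≤ k) (hjk : j ≤ k) :
    W.IsQuotient (A.functor.map (arHom le_rfl hjk : ar h ⟶ ar h'))
      (A.functor.map (arHom h le_rfl : ar h' ⟶ ar hjk)) := by
  have hz : Limits.IsZero (A.functor.obj (Arrow.mk (𝟙 j))) := by
    rw [A.obj_diag]
    exact W.isZero_zero
  exact IsQuotient.of_isPushout hz (A.isPushout (homOfLE h) (homOfLE hjk))

/-- `A_{i',j}` and `A_{i',k}` are the quotients of `A_{i,j}` and `A_{i,k}` by `A_{i,i'}`, so this is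
an instance of successive quotients. It makes the passage from row `i` to row `i'` distinguished. -/
lemma isPushout_map_arHom {i i' j k : Fin (n + 1)} (h : i ≤ j) (h' : i ≤ k) (g : i' ≤ j)
    (g' : i' ≤ k) (hjk : j ≤ k) (hi : i ≤ i') :
    IsPushout (A.functor.map (arHom le_rfl hjk : ar h ⟶ ar h'))
      (A.functor.map (arHom hi le_rfl : ar h ⟶ ar g))
      (A.functor.map (arHom hi le_rfl : ar h' ⟶ ar g'))
      (A.functor.map (arHom le_rfl hjk : ar g ⟶ ar g')) := by
  refine (isQuotient_map_arHom A hi h g).isPushout_comp (f := A.functor.map (arHom le_rfl g))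
    (r := A.functor.map (arHom hi le_rfl : ar h' ⟶ ar g')) ?_ ?_
  · rw [← Functor.map_comp, Subsingleton.elim (arHom le_rfl g ≫ arHom le_rfl hjk)
      (arHom le_rfl g' : ar hi ⟶ ar h')]
    exact isQuotient_map_arHom A hi h' g'
  · rw [← Functor.map_comp, ← Functor.map_comp]
    exact congrArg _ (Subsingleton.elim _ _)

end Ar

/-! ### From the `S`-construction to horizontal functors: rows and grids -/

section Grid

variable {n N M : SimplexCategory}

/-- A part of a row of a diagram of the `S`-construction. -/
def row (A : W.SObj N.len) (i : Fin (N.len + 1)) (r : n ⟶ N) (h : ∀ b, i ≤ r b) :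
    W.squaresCategory.HFun (Fin (n.len + 1)) :=
  hFunOfFunctor
    { obj := fun b => A.functor.obj (ar (h b))
      map := fun f => A.functor.map (arHom le_rfl (r.toOrderHom.monotone (leOfHom f)))
      map_id := fun b => by
        rw [Subsingleton.elim (arHom _ _) (𝟙 (ar (h b))), CategoryTheory.Functor.map_id]
      map_comp := fun f g => by
        rw [← Functor.map_comp]
        exact congrArg _ (Subsingleton.elim _ _) }
    (fun f => cof_map_arHom A _ _ _)

/-- The components of the map of rows. -/
def rowChangeApp {A A' : W.SObj N.len} (α : A ⟶ A') {i i' : Fin (N.len + 1)} (hi : i ≤ i')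
    {r : n ⟶ N} (h : ∀ b, i ≤ r b) (h' : ∀ b, i' ≤ r b) (b : Fin (n.len + 1)) :
    A.functor.obj (ar (h b)) ⟶ A'.functor.obj (ar (h' b)) :=
  A.functor.map (arHom hi le_rfl) ≫ (SObj.Hom.natTrans α).app (ar (h' b))

lemma rowChangeApp_id (A : W.SObj N.len) {i : Fin (N.len + 1)} {r : n ⟶ N} (h : ∀ b, i ≤ r b)
    (b : Fin (n.len + 1)) : rowChangeApp (𝟙 A) le_rfl h h b = 𝟙 _ := by
  have e : (SObj.Hom.natTrans (𝟙 A)).app (ar (h b)) = 𝟙 _ := rfl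
  rw [rowChangeApp, Subsingleton.elim (arHom _ _) (𝟙 (ar (h b))), CategoryTheory.Functor.map_id,
    Category.id_comp, e]

lemma rowChangeApp_comp {A A' A'' : W.SObj N.len} (α : A ⟶ A') (β : A' ⟶ A'')
    {i i' i'' : Fin (N.len + 1)} (hi : i ≤ i') (hi' : i' ≤ i'') {r : n ⟶ N} (h : ∀ b, i ≤ r b)
    (h' : ∀ b, i' ≤ r b) (h'' : ∀ b, i'' ≤ r b) (b : Fin (n.len + 1)) :
    rowChangeApp (α ≫ β) (hi.trans hi') h h'' b =
      rowChangeApp α hi h h' b ≫ rowChangeApp β hi' h' h'' b := by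
  have e : (SObj.Hom.natTrans (α ≫ β)).app (ar (h'' b)) =
    (SObj.Hom.natTrans α).app (ar (h'' b)) ≫ (SObj.Hom.natTrans β).app (ar (h'' b)) := rfl
  have e' : (arHom (hi.trans hi') le_rfl : ar (h b) ⟶ ar (h'' b)) =
    (arHom hi le_rfl : ar (h b) ⟶ ar (h' b)) ≫ arHom hi' le_rfl := Subsingleton.elim _ _
  simp only [rowChangeApp]
  rw [e, e', Functor.map_comp, Category.assoc, Category.assoc,
    (SObj.Hom.natTrans α).naturality_assoc]

/-- The map of rows given by a map of diagrams and an inequality. -/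
def rowChange {A A' : W.SObj N.len} (α : A ⟶ A') {i i' : Fin (N.len + 1)} (hi : i ≤ i')
    {r : n ⟶ N} (h : ∀ b, i ≤ r b) (h' : ∀ b, i' ≤ r b) : row A i r h ⟶ row A' i' r h' :=
  hFunHom (rowChangeApp α hi h h') fun {b b'} f => by
    have hb : r b ≤ r b' := r.toOrderHom.monotone (leOfHom f)
    -- Move from row `i` to row `i'` inside `A`, a pushout square; then apply the weak equivalences
    -- of `α`. Each square is distinguished, hence so is the composite.
    refine IsDist.vcomp (f := A.functor.map (arHom le_rfl hb : ar (h b) ⟶ ar (h b')))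
      (f' := A.functor.map (arHom le_rfl hb : ar (h' b) ⟶ ar (h' b')))
      (f'' := A'.functor.map (arHom le_rfl hb : ar (h' b) ⟶ ar (h' b')))
      (cof_map_arHom A _ _ _) (cof_map_arHom A _ _ _)
      (W.isDist_of_isPushout (isPushout_map_arHom A _ _ _ _ hb hi))
      (W.isDist_of_weq (cof_map_arHom A _ _ _) (cof_map_arHom A' _ _ _) ?_
        (SObj.Hom.weq α _) (SObj.Hom.weq α _))
    exact (SObj.Hom.natTrans α).naturality _

/-- The rows of a chain of diagrams. -/
def grid (z : Fin (N.len + 1) ⥤ W.SObj N.len) (l r : n ⟶ N) (h : ∀ a b, l a ≤ r b) :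
    Fin (n.len + 1) ⥤ W.squaresCategory.HFun (Fin (n.len + 1)) where
  -- The entry at `(a, b)` is `A^{r(a)}_{l(a),r(b)}`, which exists for all `a`, `b` exactly because
  -- `l ≤ r`.
  obj a := row (z.obj (r a)) (l a) r (h a)
  map f := rowChange (z.map (homOfLE (r.toOrderHom.monotone (leOfHom f))))
    (l.toOrderHom.monotone (leOfHom f)) (h _) (h _)
  map_id a := hFun_hom_ext fun b =>
    (congrArg (fun α => rowChangeApp α le_rfl (h a) (h a) b) (z.map_id (r a))).trans
      (rowChangeApp_id _ (h a) b)
  map_comp {a a' a''} f g := hFun_hom_ext fun b =>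
    (congrArg (fun α => rowChangeApp α (l.toOrderHom.monotone (leOfHom (f ≫ g))) (h a) (h a'') b)
      (z.map_comp (homOfLE (r.toOrderHom.monotone (leOfHom f)))
        (homOfLE (r.toOrderHom.monotone (leOfHom g))))).trans
      (rowChangeApp_comp _ _ (l.toOrderHom.monotone (leOfHom f))
        (l.toOrderHom.monotone (leOfHom g)) (h a) (h a') (h a'') b)

variable (W) in
/-- The map from the edgewise subdivision of the `S`-construction given by rows. -/
def sdGrid : Realization.sd (SimplicialCat.diagNerve W.wS) ⟶
    SimplicialCat.diagNerve W.squaresCategory.T :=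
  Realization.sdDesc (fun z l r h => grid z l r h) (fun _ _ _ _ _ => rfl) (fun _ _ _ _ _ => rfl)

end Grid

end WaldhausenCategory

namespace WaldhausenCategory

variable {C : Type u} [Category.{v} C] {W : WaldhausenCategory C}

/-! ### Comparison on the side of horizontal functors -/

section ProjGrid

variable {n N : SimplexCategory}

/-- The restriction of a simplex of the diagonal. -/
abbrev restrictT (z : Fin (N.len + 1) ⥤ W.squaresCategory.HFun (Fin (N.len + 1))) (r : n ⟶ N) :
    Fin (n.len + 1) ⥤ W.squaresCategory.HFun (Fin (n.len + 1)) :=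
  r.toOrderHom.monotone.functor ⋙ z ⋙
    SquaresCategory.HFun.precomp r.toOrderHom.monotone.functor

/-- The projections from the rows of a horizontal functor to their quotients. -/
noncomputable def projRow (F : W.squaresCategory.HFun (Fin (N.len + 1))) (i : Fin (N.len + 1))
    (r : n ⟶ N) (h : ∀ b, i ≤ r b) :
    (SquaresCategory.HFun.precomp r.toOrderHom.monotone.functor).obj F ⟶
      row (quotSObj F) i r h :=
  hFunHom (fun b => quotProj F (ar (h b))) fun {b _} f =>
    W.isDist_of_isPushout (quotFunctor_isPushout_proj F (homOfLE (h b))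
      (homOfLE (r.toOrderHom.monotone (leOfHom f))))

/-- Projecting to `F(j)/F(i)` and then to `F(j)/F(i')` is projecting to `F(j)/F(i')`. This gives
naturality of `projGrid`, where the chain and the row index move together. -/
lemma comp_quotProj {m : ℕ} {F G : W.squaresCategory.HFun (Fin (m + 1))} (α : F ⟶ G)
    {i i' j : Fin (m + 1)} (hi : i ≤ i') (h : i ≤ j) (h' : i' ≤ j) :
    comp α j ≫ quotProj G (ar h') = quotProj F (ar h) ≫
      (quotFunctor F).map (arHom hi le_rfl : ar h ⟶ ar h') ≫ quotApp α (ar h') := by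
  have e : quotProj F (ar h) ≫ (quotFunctor F).map (arHom hi le_rfl : ar h ⟶ ar h') =
      quotProj F (ar h') :=
    (quotProj_map F _).trans ((congrArg (fun f : ob F j ⟶ ob F j => f ≫ quotProj F (ar h'))
      (mor_id F j)).trans (Category.id_comp _))
  exact ((Category.assoc _ _ _).symm.trans ((congrArg
    (fun f : ob F j ⟶ (quotFunctor F).obj (ar h') => f ≫ quotApp α (ar h')) e).trans
      (quotProj_app α (ar h')))).symm

/-- The natural transformation given by the projections to the quotients. -/
noncomputable def projGrid (z : Fin (N.len + 1) ⥤ W.squaresCategory.HFun (Fin (N.len + 1)))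
    (l r : n ⟶ N) (h : ∀ a b, l a ≤ r b) :
    restrictT z r ⟶ grid (z ⋙ quotSFunctor N.len) l r h where
  app a := projRow (z.obj (r a)) (l a) r (h a)
  naturality _ _ f := hFun_hom_ext fun b =>
    comp_quotProj (z.map (homOfLE (r.toOrderHom.monotone (leOfHom f))))
      (l.toOrderHom.monotone (leOfHom f)) (h _ b) (h _ b)

variable (W) in
/-- The homotopy on the side of horizontal functors. -/
noncomputable def sdProjGrid :
    Realization.sd (SimplicialCat.diagNerve W.squaresCategory.T) ⟶
      SimplicialCat.diagNerve (SimplicialCat.arrows.{v, u} W.squaresCategory.T) :=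
  Realization.sdDesc (fun z l r h => NatTrans.toArrowFunctor (projGrid z l r h))
    (fun _ _ _ _ _ => rfl) (fun _ _ _ _ _ => rfl)

/-- Together with `sdProjGrid_target` this identifies the ends of the homotopy: one is the
restriction to the second half, the other is quotients followed by rows. -/
lemma sdProjGrid_source : sdProjGrid W ≫ SimplicialCat.diagNerveMap
    (SimplicialCat.arrowsSource.{v, u} W.squaresCategory.T) = Realization.sdLast _ := rfl

lemma sdProjGrid_target : sdProjGrid W ≫ SimplicialCat.diagNerveMap
    (SimplicialCat.arrowsTarget.{v, u} W.squaresCategory.T) =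
      Realization.sdMap (SimplicialCat.diagNerveMap (quotT W)) ≫ sdGrid W := rfl

end ProjGrid

/-! ### Comparison on the side of the `S`-construction -/

section QuotRow

variable {n N : SimplexCategory}

/-- The image of an arrow under a morphism of the simplex category. -/
abbrev imageAr (r : n ⟶ N) (x : Arrow (Fin (n.len + 1))) : Arrow (Fin (N.len + 1)) :=
  ar (r.toOrderHom.monotone (leOfHom x.hom))

/-- The quotients of a row are the entries `A_{j,k}`, whichever row `i` was chosen. Thus taking
quotients of rows recovers the diagram up to isomorphism. -/
lemma isQuotient_row (A : W.SObj N.len) {i : Fin (N.len + 1)} {r : n ⟶ N} (h : ∀ b, i ≤ r b)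
    (x : Arrow (Fin (n.len + 1))) :
    W.IsQuotient (mor (row A i r h) x.hom)
      (A.functor.map (arHom (h x.left) le_rfl : ar (h x.right) ⟶ imageAr r x)) :=
  isQuotient_map_arHom A _ _ _

/-- The comparison of the chosen quotients of a row with the given ones. -/
noncomputable def quotRowApp (A : W.SObj N.len) {i : Fin (N.len + 1)} {r : n ⟶ N}
    (h : ∀ b, i ≤ r b) (x : Arrow (Fin (n.len + 1))) :
    (quotFunctor (row A i r h)).obj x ⟶ A.functor.obj (imageAr r x) :=
  (isQuotient_quotProj (row A i r h) x).map (isQuotient_row A h x) (𝟙 _) (𝟙 _)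
    ((Category.comp_id _).trans (Category.id_comp _).symm)

lemma quotProj_quotRowApp (A : W.SObj N.len) {i : Fin (N.len + 1)} {r : n ⟶ N}
    (h : ∀ b, i ≤ r b) (x : Arrow (Fin (n.len + 1))) :
    quotProj (row A i r h) x ≫ quotRowApp A h x =
      A.functor.map (arHom (h x.left) le_rfl : ar (h x.right) ⟶ imageAr r x) :=
  ((isQuotient_quotProj (row A i r h) x).comp_map _ _ _ _).trans (Category.id_comp _)

lemma weq_quotRowApp (A : W.SObj N.len) {i : Fin (N.len + 1)} {r : n ⟶ N}
    (h : ∀ b, i ≤ r b) (x : Arrow (Fin (n.len + 1))) : W.weq (quotRowApp A h x) := by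
  have := (isQuotient_quotProj (row A i r h) x).isIso_of_comp_eq (isQuotient_row A h x)
    (quotProj_quotRowApp A h x)
  exact W.weq_of_isIso _

lemma quotRowApp_naturality (A : W.SObj N.len) {i : Fin (N.len + 1)} {r : n ⟶ N}
    (h : ∀ b, i ≤ r b) {x y : Arrow (Fin (n.len + 1))} (φ : x ⟶ y) :
    (quotFunctor (row A i r h)).map φ ≫ quotRowApp A h y =
      quotRowApp A h x ≫ A.functor.map (arHom (r.toOrderHom.monotone (leOfHom φ.left))
        (r.toOrderHom.monotone (leOfHom φ.right)) : imageAr r x ⟶ imageAr r y) := by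
  refine (isQuotient_quotProj (row A i r h) x).hom_ext ?_
  have e : mor (row A i r h) φ.right = A.functor.map
    (arHom le_rfl (r.toOrderHom.monotone (leOfHom φ.right)) : ar (h x.right) ⟶ ar (h y.right)) :=
    rfl
  rw [← Category.assoc, quotProj_map, Category.assoc, quotProj_quotRowApp, ← Category.assoc,
    quotProj_quotRowApp, e]
  refine (A.functor.map_comp _ _).symm.trans (Eq.trans ?_ (A.functor.map_comp _ _))
  exact congrArg _ (Subsingleton.elim _ _)

/-- The comparison of the chosen quotients of a row with the given ones. -/
noncomputable def quotRow (A : W.SObj N.len) {i : Fin (N.len + 1)} {r : n ⟶ N}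
    (h : ∀ b, i ≤ r b) :
    quotSObj (row A i r h) ⟶ (SObj.precomp r.toOrderHom).obj A :=
  SObj.Hom.mk
    { app := fun x => quotRowApp A h x
      naturality := fun _ _ φ => quotRowApp_naturality A h φ }
    (fun x => weq_quotRowApp A h x)

lemma map_arHom_natTrans {m : ℕ} {A A' : W.SObj m} (α : A ⟶ A') {i i' j k : Fin (m + 1)}
    (hi : i ≤ i') (h : i ≤ k) (h' : i' ≤ k) (hj : i ≤ j) (hj' : i' ≤ j) (hjk : j ≤ k) :
    A.functor.map (arHom hi le_rfl : ar h ⟶ ar h') ≫ (SObj.Hom.natTrans α).app (ar h') ≫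
        A'.functor.map (arHom hj' le_rfl : ar h' ⟶ ar hjk) =
      A.functor.map (arHom hj le_rfl : ar h ⟶ ar hjk) ≫ (SObj.Hom.natTrans α).app (ar hjk) := by
  rw [← (SObj.Hom.natTrans α).naturality, ← Category.assoc, ← CategoryTheory.Functor.map_comp]
  rfl

lemma quotApp_rowChange {A A' : W.SObj N.len} (α : A ⟶ A') {i i' : Fin (N.len + 1)}
    (hi : i ≤ i') {r : n ⟶ N} (h : ∀ b, i ≤ r b) (h' : ∀ b, i' ≤ r b)
    (x : Arrow (Fin (n.len + 1))) :
    quotApp (rowChange α hi h h') x ≫ quotRowApp A' h' x =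
      quotRowApp A h x ≫ (SObj.Hom.natTrans α).app (imageAr r x) := by
  refine (isQuotient_quotProj (row A i r h) x).hom_ext ?_
  have e : comp (rowChange α hi h h') x.right = A.functor.map (arHom hi le_rfl) ≫
    (SObj.Hom.natTrans α).app (ar (h' x.right)) := rfl
  rw [← Category.assoc, quotProj_app, Category.assoc, quotProj_quotRowApp, ← Category.assoc,
    quotProj_quotRowApp, e]
  refine (Category.assoc _ _ _).trans ?_
  exact map_arHom_natTrans α hi (h x.right) (h' x.right) (h x.left) (h' x.left) _

/-- The restriction of a simplex of the diagonal. -/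
abbrev restrictS (z : Fin (N.len + 1) ⥤ W.SObj N.len) (r : n ⟶ N) :
    Fin (n.len + 1) ⥤ W.SObj n.len :=
  r.toOrderHom.monotone.functor ⋙ z ⋙ SObj.precomp r.toOrderHom

/-- The natural transformation given by the comparison of quotients. -/
noncomputable def quotGrid (z : Fin (N.len + 1) ⥤ W.SObj N.len) (l r : n ⟶ N)
    (h : ∀ a b, l a ≤ r b) : grid z l r h ⋙ quotSFunctor n.len ⟶ restrictS z r where
  app a := quotRow (z.obj (r a)) (h a)
  naturality _ _ _ := SObj.Hom.ext (NatTrans.ext (funext fun x =>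
    quotApp_rowChange _ _ _ _ x))

variable (W) in
/-- The homotopy on the side of the `S`-construction. -/
noncomputable def sdQuotGrid :
    Realization.sd (SimplicialCat.diagNerve W.wS) ⟶
      SimplicialCat.diagNerve (SimplicialCat.arrows.{v, u} W.wS) :=
  Realization.sdDesc (fun z l r h => NatTrans.toArrowFunctor (quotGrid z l r h))
    (fun _ _ _ _ _ => rfl) (fun _ _ _ _ _ => rfl)

lemma sdQuotGrid_source : sdQuotGrid W ≫ SimplicialCat.diagNerveMap
    (SimplicialCat.arrowsSource.{v, u} W.wS) =
      sdGrid W ≫ SimplicialCat.diagNerveMap (quotT W) := rfl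

lemma sdQuotGrid_target : sdQuotGrid W ≫ SimplicialCat.diagNerveMap
    (SimplicialCat.arrowsTarget.{v, u} W.wS) = Realization.sdLast _ := rfl

end QuotRow

/-! ### Base points -/

section Base

lemma subsingleton_hom_of_eq_zero {A B : C} (hA : A = W.zero) : Subsingleton (A ⟶ B) := by
  subst hA
  exact ⟨W.isZero_zero.eq_of_src⟩

lemma sObj_obj_eq_zero (A : W.SObj 0) (x : Arrow (Fin 1)) : A.functor.obj x = W.zero := by
  have hx : x = Arrow.mk (𝟙 0) := by
    obtain ⟨i, j, f⟩ := x
    obtain rfl := Subsingleton.elim i 0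
    obtain rfl := Subsingleton.elim j 0
    rfl
  rw [hx]
  exact A.obj_diag 0

/-- The diagonal entries equal the zero object strictly, so `wS_0 C` has just one object and base
points match automatically on this side. -/
lemma sObj_zero_eq (A : W.SObj 0) : A = W.baseS₀ := by
  have h : A.functor = (Functor.const (Arrow (Fin 1))).obj W.zero := by
    refine Functor.hext (sObj_obj_eq_zero A) fun x y f => ?_
    have := subsingleton_hom_of_eq_zero (B := A.functor.obj y) (sObj_obj_eq_zero A x)
    refine Subsingleton.helim ?_ _ _
    rw [sObj_obj_eq_zero A x, sObj_obj_eq_zero A y]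
    rfl
  obtain ⟨F, _, _, _⟩ := A
  subst h
  rfl

lemma sObj_hom_eq {A B : W.SObj 0} (f g : A ⟶ B) : f = g :=
  SObj.Hom.ext (NatTrans.ext (funext fun x =>
    (subsingleton_hom_of_eq_zero (sObj_obj_eq_zero A x)).elim _ _))

/-- Unlike `wS_0 C`, the category `T_0 C'` has an object for every object of `C`, so matching base
points requires the value to be exactly the zero object. -/
lemma hFun_zero_eq (F : W.squaresCategory.HFun (Fin 1)) (h : ob F 0 = W.zero) :
    F = W.squaresCategory.baseT₀ := by
  have hob : ∀ i, F.functor.obj i = W.zero := fun i => by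
    obtain rfl := Subsingleton.elim i 0
    exact h
  have : F.functor = (Functor.const (Fin 1)).obj
      (show W.squaresCategory.Hor from W.squaresCategory.base) := by
    refine Functor.hext hob fun x y f => ?_
    obtain rfl := Subsingleton.elim x y
    obtain rfl := Subsingleton.elim f (𝟙 x)
    rw [CategoryTheory.Functor.map_id, CategoryTheory.Functor.map_id, hob x]
    rfl
  obtain ⟨F⟩ := F
  subst this
  rfl

lemma hFun_hom_eq (f : W.squaresCategory.baseT₀ ⟶ W.squaresCategory.baseT₀) : f = 𝟙 _ :=
  hFun_hom_ext fun _ => W.isZero_zero.eq_of_src _ _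

lemma arrow_hFun_eq {F G : W.squaresCategory.HFun (Fin 1)} (f : F ⟶ G)
    (hF : ob F 0 = W.zero) (hG : ob G 0 = W.zero) :
    Arrow.mk f = Arrow.mk (𝟙 (show W.squaresCategory.HFun (Fin 1) from
      W.squaresCategory.baseT₀)) := by
  obtain rfl := hFun_zero_eq F hF
  obtain rfl := hFun_zero_eq G hG
  exact congrArg Arrow.mk (hFun_hom_eq f)

lemma arrow_sObj_eq {A B : W.SObj 0} (f : A ⟶ B) :
    Arrow.mk f = Arrow.mk (𝟙 (show W.SObj 0 from W.baseS₀)) := by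
  obtain rfl := sObj_zero_eq A
  obtain rfl := sObj_zero_eq B
  exact congrArg Arrow.mk (sObj_hom_eq f _)

end Base

end WaldhausenCategory

namespace WaldhausenCategory

variable {C : Type u} [Category.{v} C] (W : WaldhausenCategory C)

/-! ### The comparison of realizations -/

open Realization SimplicialCat

/-- The vertex of the edgewise subdivision given by the base object of `T`. -/
def sdBaseT : (sd (diagNerve W.squaresCategory.T)).obj (op ⦋0⦌) :=
  (diagNerve W.squaresCategory.T).map
    (SimplexCategory.const (SimplexCategory.double ⦋0⦌) ⦋0⦌ 0).op
    (ComposableArrows.mk₀ W.squaresCategory.baseT₀)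

/-- The vertex of the edgewise subdivision given by the base object of the `S`-construction. -/
def sdBaseS : (sd (diagNerve W.wS)).obj (op ⦋0⦌) :=
  (diagNerve W.wS).map (SimplexCategory.const (SimplexCategory.double ⦋0⦌) ⦋0⦌ 0).op
    (ComposableArrows.mk₀ W.baseS₀)

lemma quotT_base : (diagNerveMap (quotT W)).app (op ⦋0⦌)
    (ComposableArrows.mk₀ W.squaresCategory.baseT₀) = ComposableArrows.mk₀ W.baseS₀ :=
  ComposableArrows.ext₀ (sObj_zero_eq _)

lemma sdGrid_base : (sdGrid W).app (op ⦋0⦌) (sdBaseS W) =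
    ComposableArrows.mk₀ W.squaresCategory.baseT₀ :=
  ComposableArrows.ext₀ (hFun_zero_eq _ rfl)

lemma sdProjGrid_base : (sdProjGrid W).app (op ⦋0⦌) (sdBaseT W) =
    (diagNerveMap (arrowsId.{v, max u v} W.squaresCategory.T)).app (op ⦋0⦌)
      (ComposableArrows.mk₀ W.squaresCategory.baseT₀) :=
  -- The target of the projection is the chosen quotient of the identity of the zero object, which
  -- was chosen to be zero itself.
  ComposableArrows.ext₀ (arrow_hFun_eq _ rfl (by
    have : IsIso (𝟙 W.zero) := inferInstance
    exact quot_eq_zero (𝟙 W.zero) (W.cof_of_isIso _)))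

lemma sdQuotGrid_base : (sdQuotGrid W).app (op ⦋0⦌) (sdBaseS W) =
    (diagNerveMap (arrowsId.{v, max u v} W.wS)).app (op ⦋0⦌) (ComposableArrows.mk₀ W.baseS₀) :=
  ComposableArrows.ext₀ (arrow_sObj_eq _)

/-- The map from the realization of the `S`-construction to that of the squares category. -/
noncomputable def rowMap : C(realization W.wS, realization W.squaresCategory.T) :=
  (SSet.toTop.map (sdGrid W)).hom.comp (subdivision (diagNerve W.wS))

/-- The map from the realization of the squares category to that of the `S`-construction. -/
noncomputable def quotMap : C(realization W.squaresCategory.T, realization W.wS) :=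
  (SSet.toTop.map (diagNerveMap (quotT W))).hom

lemma rowMap_basePoint : rowMap W W.basePoint = W.squaresCategory.basePoint :=
  (congrArg (SSet.toTop.map (sdGrid W)) (subdivision_vertexPoint _)).trans
    ((toTop_map_vertexPoint (sdGrid W) (sdBaseS W)).trans (congrArg _ (sdGrid_base W)))

lemma quotMap_basePoint : quotMap W W.squaresCategory.basePoint = W.basePoint :=
  (toTop_map_vertexPoint _ _).trans (congrArg _ (quotT_base W))

/-- Both the composite and the identity are homotopic, relative to the base point, to the
restriction to the second half after subdivision: the former by `sdQuotGrid`, the latter by the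
deformation. -/
lemma loopMap_quotMap_rowMap :
    ((loopMap (quotMap W) (quotMap_basePoint W)).comp
      (loopMap (rowMap W) (rowMap_basePoint W))).Homotopic (ContinuousMap.id _) := by
  have hb : (quotMap W).comp (rowMap W) W.basePoint = W.basePoint :=
    (congrArg (quotMap W) (rowMap_basePoint W)).trans (quotMap_basePoint W)
  obtain ⟨D, hD₀, hD₁, hD⟩ := exists_deformation (diagNerve W.wS)
  obtain ⟨H, hH₀, hH₁, hH⟩ := exists_homotopy_of_arrows (sdQuotGrid W)
  have hlast : ((SSet.toTop.map (sdLast (diagNerve W.wS))).hom.comp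
      (subdivision (diagNerve W.wS))) W.basePoint = W.basePoint :=
    (hD₁ _).symm.trans (hD _ 1)
  have e₁ := loopMap_homotopic (A := realization W.wS) (B := realization W.wS)
    hb hlast (H.comp (subdivision (diagNerve W.wS)))
    (fun a => (hH₀ _).trans (by rw [sdQuotGrid_source, Functor.map_comp]; rfl))
    (fun a => (hH₁ _).trans (by rw [sdQuotGrid_target]; rfl))
    (fun s => (congrArg (fun p => H p s) (subdivision_vertexPoint _)).trans
      (hH _ _ (sdQuotGrid_base W) s))
  have e₂ := loopMap_homotopic (A := realization W.wS) (B := realization W.wS)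
    (f := ContinuousMap.id _) rfl hlast D hD₀ hD₁ (hD _)
  exact e₁.trans e₂.symm

lemma loopMap_rowMap_quotMap :
    ((loopMap (rowMap W) (rowMap_basePoint W)).comp
      (loopMap (quotMap W) (quotMap_basePoint W))).Homotopic (ContinuousMap.id _) := by
  have hb : (rowMap W).comp (quotMap W) W.squaresCategory.basePoint =
      W.squaresCategory.basePoint :=
    (congrArg (rowMap W) (quotMap_basePoint W)).trans (rowMap_basePoint W)
  obtain ⟨D, hD₀, hD₁, hD⟩ := exists_deformation (diagNerve W.squaresCategory.T)
  obtain ⟨H, hH₀, hH₁, hH⟩ := exists_homotopy_of_arrows (sdProjGrid W)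
  have hlast : ((SSet.toTop.map (sdLast (diagNerve W.squaresCategory.T))).hom.comp
      (subdivision (diagNerve W.squaresCategory.T))) W.squaresCategory.basePoint =
        W.squaresCategory.basePoint :=
    (hD₁ _).symm.trans (hD _ 1)
  have e₁ := loopMap_homotopic (A := realization W.squaresCategory.T)
    (B := realization W.squaresCategory.T)
    hlast hb (H.comp (subdivision (diagNerve W.squaresCategory.T)))
    (fun a => (hH₀ _).trans (by rw [sdProjGrid_source]; rfl))
    (fun a => (hH₁ _).trans (by
      rw [sdProjGrid_target, Functor.map_comp]
      -- Here quotients are taken after subdividing, while the composite takes them before;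
      -- naturality of the subdivision exchanges the two.
      exact congrArg (SSet.toTop.map (sdGrid W)) (subdivision_naturality _ a).symm))
    (fun s => (congrArg (fun p => H p s) (subdivision_vertexPoint _)).trans
      (hH _ _ (sdProjGrid_base W) s))
  have e₂ := loopMap_homotopic (A := realization W.squaresCategory.T)
    (B := realization W.squaresCategory.T)
    (f := ContinuousMap.id _) rfl hlast D hD₀ hD₁ (hD _)
  exact (e₂.trans e₁).symm

end WaldhausenCategory

/-- The Waldhausen K-theory space `Ω|wS_• C|` is homotopy equivalent, as a loop space, to the
K-theory space `Ω_O|N_• T_• C'|` of the associated squares category `C'`: there is a homotopy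
equivalence that is obtained by looping a based map `|wS_• C| ⟶ |N_• T_• C'|`. -/
theorem mainTheorem6 {C : Type u} [Category.{v} C] (W : WaldhausenCategory C) :
    ∃ (e : W.K ≃ₕ W.squaresCategory.K)
      (φ : C(SimplicialCat.realization W.wS, SimplicialCat.realization W.squaresCategory.T)),
      φ W.basePoint = W.squaresCategory.basePoint ∧
        ∀ (γ : W.K) (t : unitInterval), e γ t = φ (γ t) :=
  ⟨⟨loopMap W.rowMap W.rowMap_basePoint, loopMap W.quotMap W.quotMap_basePoint,
    W.loopMap_quotMap_rowMap, W.loopMap_rowMap_quotMap⟩, W.rowMap, W.rowMap_basePoint,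
    fun _ _ => rfl⟩
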